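/- Let $(U_i,\varepsilon_i)_{i\ge 1}$ be i.i.d. with $U_i\sim U[0,1]$, and suppose that there are constants $0<\underline\sigma^2\le\bar\sigma^2<\infty$ and $\bar\kappa_3<\infty$ such that, almost surely, $E[\varepsilon_i\mid U_i]=0$, $\underline\sigma^2\le E[\varepsilon_i^2\mid U_i]\le\bar\sigma^2$ and $E[|\varepsilon_i|^3\mid U_i]\le\bar\kappa_3$. Let $f:[0,1]^2\to[0,1]$ be measurable with $\int_{[0,1]^2} f(u,v)\,du\,dv>0$, let $p_n\in(0,1]$, and let $A$ be the symmetric $n\times n$ matrix with $A_{ij}=A_{ji}=p_n f(U_i,U_j)$ for $i<j$ and $A_{ii}=0$. Let $\iota_n=(1,\dots,1)'\in\mathbb R^n$ and consider the centralities $$C^{(1)}=A\iota_n,\qquad C^{(T)}=\Big(\sum_{t=1}^T\delta^tA^t\Big)\iota_n,\qquad C^{(\infty)}=a_nv_1(A),$$ where $T\ge 1$ and $\delta\in(0,1]$ are fixed, $a_n>0$, and $v_1(A)$ is a (measurably chosen) eigenvector of $A$ of Euclidean length $1$ belonging to an eigenvalue of largest absolute value. For $d\in\{1,T,\infty\}$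 let $\beta^{(d)}\in\mathbb R$, $Y_i=\beta^{(d)}C_i^{(d)}+\varepsilon_i$ for $1\le i\le n$, and $$\tilde\beta^{(d)}=\frac{\sum_{i}Y_iC_i^{(d)}}{\sum_{i}(C_i^{(d)})^2},\qquad \tilde\varepsilon_i^{(d)}=Y_i-\tilde\beta^{(d)}C_i^{(d)},\qquad \tilde V^{(d)}=\Big(\sum_{i=1}^n (C_i^{(d)})^2\Big)^{-2}\sum_{i=1}^n (C_i^{(d)})^2(\tilde\varepsilon_i^{(d)})^2 .$$ (a) If $p_n/n^{-3/2}\to\infty$, then for $d\in\{1,T\}$, $$\frac{\tilde\beta^{(d)}-\beta^{(d)}}{\sqrt{\tilde V^{(d)}}}\ \xrightarrow{d}\ N(0,1)\quad\text{as } n\to\infty.$$ (b) If $a_n\to\infty$, then $$\frac{\tilde\beta^{(\infty)}-\beta^{(\infty)}}{\sqrt{\tilde V^{(\infty)}}}\ \xrightarrow{d}\ N(0,1)\quad\text{as } n\to\infty.$$ -/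

import Mathlib

open MeasureTheory ProbabilityTheory Filter Topology
open scoped unitInterval Matrix

noncomputable section

namespace CentralityOLS

/-- A graphon: a measurable `f : [0,1]² → [0,1]` with `∫ f > 0`. No symmetry is imposed on `f`, since
only its values above the diagonal of the adjacency matrix are used. -/
structure IsGraphon (f : I → I → ℝ) : Prop where
  measurable : Measurable (Function.uncurry f)
  nonneg : ∀ u v, 0 ≤ f u v
  le_one : ∀ u v, f u v ≤ 1
  integral_pos : 0 < ∫ z : I × I, f z.1 z.2

/-- The latent types and errors `(U i, ε i)` of the agents are i.i.d., with `U i ∼ U[0,1]`. -/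
structure IsSample {Ω : Type*} [MeasurableSpace Ω] (P : Measure Ω)
    (U : ℕ → Ω → I) (ε : ℕ → Ω → ℝ) : Prop where
  measurable_type : ∀ i, Measurable (U i)
  measurable_error : ∀ i, Measurable (ε i)
  indep : iIndepFun (fun i ω => (U i ω, ε i ω)) P
  identDistrib : ∀ i, IdentDistrib (fun ω => (U i ω, ε i ω)) (fun ω => (U 0 ω, ε 0 ω)) P P
  uniform : ∀ i, P.map (U i) = volume

/-- Conditional expectation `E[X | V]` given the random variable `V`, as a random variable. -/
abbrev condExpGiven {Ω α : Type*} [MeasurableSpace Ω] [MeasurableSpace α] (P : Measure Ω)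
    (X : Ω → ℝ) (V : Ω → α) : Ω → ℝ :=
  P[X | MeasurableSpace.comap V inferInstance]

/-- The assumptions on the moments of `ε i` given `U i`:
`E[ε|U] = 0`, `0 < σlo² ≤ E[ε²|U] ≤ σhi² < ∞` and `E[|ε|³|U] ≤ κ₃ < ∞`.
Integrability of `|ε|³` (which the finite bound on `E[|ε|³|U]` entails) is recorded explicitly,
because Mathlib's conditional expectation of a non-integrable function is `0`. -/
structure CondMoments {Ω : Type*} [MeasurableSpace Ω] (P : Measure Ω)
    (U : ℕ → Ω → I) (ε : ℕ → Ω → ℝ) (σlo σhi κ₃ : ℝ) : Prop where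
  integrable : ∀ i, Integrable (fun ω => |ε i ω| ^ 3) P
  mean_zero : ∀ i, condExpGiven P (ε i) (U i) =ᵐ[P] 0
  σlo_pos : 0 < σlo
  var_lower : ∀ i, ∀ᵐ ω ∂P, σlo ^ 2 ≤ condExpGiven P (fun ω => ε i ω ^ 2) (U i) ω
  var_upper : ∀ i, ∀ᵐ ω ∂P, condExpGiven P (fun ω => ε i ω ^ 2) (U i) ω ≤ σhi ^ 2
  third_moment : ∀ i, ∀ᵐ ω ∂P, condExpGiven P (fun ω => |ε i ω| ^ 3) (U i) ω ≤ κ₃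

/-- The true network of `n` agents with types `u` at sparsity level `p`:
`A i j = p * f (u i) (u j)` for `i < j`, extended symmetrically, with zero diagonal. -/
def adjacency (f : I → I → ℝ) (p : ℝ) {n : ℕ} (u : Fin n → I) : Matrix (Fin n) (Fin n) ℝ :=
  Matrix.of fun i j =>
    if i < j then p * f (u i) (u j) else if j < i then p * f (u j) (u i) else 0

/-- Degree centrality `A ι`. -/
def degreeCentrality {n : ℕ} (A : Matrix (Fin n) (Fin n) ℝ) : Fin n → ℝ :=
  A *ᵥ 1

/-- Diffusion centrality `(∑_{t=1}^T δ^t A^t) ι`. -/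
def diffusionCentrality (δ : ℝ) (T : ℕ) {n : ℕ} (A : Matrix (Fin n) (Fin n) ℝ) : Fin n → ℝ :=
  (∑ t ∈ Finset.Icc 1 T, δ ^ t • A ^ t) *ᵥ 1

/-- `v` is a leading eigenvector of the (symmetric) matrix `A`, of Euclidean length `1`: its
eigenvalue has the largest absolute value among all eigenvalues of `A`. -/
def IsLeadingEigenvector {n : ℕ} (A : Matrix (Fin n) (Fin n) ℝ) (v : Fin n → ℝ) : Prop :=
  v ⬝ᵥ v = 1 ∧ ∃ lam : ℝ, A *ᵥ v = lam • v ∧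
    ∀ μ : ℝ, Module.End.HasEigenvalue (Matrix.toLin' A) μ → |μ| ≤ |lam|

/-- `v₁` is a version of the map `A ↦ v₁(A)`: a measurable choice of a unit leading eigenvector of
every nonempty real symmetric matrix. Where the leading eigenvector is determined only up to sign,
or where the leading eigenvalue is not simple, the choice is arbitrary. -/
structure IsLeadingEigenvectorMap
    (v₁ : (n : ℕ) → Matrix (Fin n) (Fin n) ℝ → Fin n → ℝ) : Prop where
  measurable : ∀ n, Measurable fun M : Fin n → Fin n → ℝ => v₁ n (Matrix.of M)
  leading : ∀ n, 1 ≤ n → ∀ A : Matrix (Fin n) (Fin n) ℝ, A.IsSymm →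
    IsLeadingEigenvector A (v₁ n A)

/-- Eigenvector centrality `a v₁(A)`. -/
def eigenvectorCentrality (v₁ : (n : ℕ) → Matrix (Fin n) (Fin n) ℝ → Fin n → ℝ) (a : ℝ)
    {n : ℕ} (A : Matrix (Fin n) (Fin n) ℝ) : Fin n → ℝ :=
  a • v₁ n A

/-- The outcomes of the regression model, `Y i = β C i + ε i`. -/
def outcome {n : ℕ} (β : ℝ) (C e : Fin n → ℝ) : Fin n → ℝ :=
  fun i => β * C i + e i

/-- The OLS estimator `Y'C / C'C`. -/
def olsEstimator {n : ℕ} (Y C : Fin n → ℝ) : ℝ :=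
  (Y ⬝ᵥ C) / (C ⬝ᵥ C)

/-- The regression residuals `Y i - β̃ C i`. -/
def residual {n : ℕ} (Y C : Fin n → ℝ) (i : Fin n) : ℝ :=
  Y i - olsEstimator Y C * C i

/-- The heteroskedasticity-robust variance estimator
`(∑ (C i)²)⁻² ∑ (C i)² (residual i)²`. -/
def robustVariance {n : ℕ} (Y C : Fin n → ℝ) : ℝ :=
  ((∑ i, C i ^ 2) ^ 2)⁻¹ * ∑ i, C i ^ 2 * residual Y C i ^ 2

/-- The heteroskedasticity-robust t-statistic `(β̃ - β) / √Ṽ`. -/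
def tStatistic {n : ℕ} (Y C : Fin n → ℝ) (β : ℝ) : ℝ :=
  (olsEstimator Y C - β) / √(robustVariance Y C)

/-- For every `n`, the network of the first `n` agents is formed with sparsity `p n`, the centrality
`C n` of that network is the regressor, and outcomes are generated with slope `β`; this is the
t-statistic as a random variable. -/
def tStat {Ω : Type*} (f : I → I → ℝ) (p : ℕ → ℝ) (U : ℕ → Ω → I) (ε : ℕ → Ω → ℝ)
    (C : (n : ℕ) → Matrix (Fin n) (Fin n) ℝ → Fin n → ℝ) (β : ℝ) (n : ℕ) (ω : Ω) : ℝ :=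
  let c : Fin n → ℝ := C n (adjacency f (p n) fun i => U i ω)
  tStatistic (outcome β c fun i => ε i ω) c β

/-- Convergence in distribution of a sequence of real random variables to `N(0,1)`. -/
def AsympStdNormal {Ω : Type*} [MeasurableSpace Ω] (P : Measure Ω) [IsProbabilityMeasure P]
    (S : ℕ → Ω → ℝ) : Prop :=
  TendstoInDistribution S atTop (id : ℝ → ℝ) (fun _ => P) (gaussianReal 0 1)

end CentralityOLS

end

/-! The t-statistic sees the regressor `C` only through its direction `w = C / ‖C‖`. With `Z = ∑ w i
* ε i` it equals `Z / √(∑ (w i)² (ε i - Z * w i)²)`, so the scale of the centrality cancels. Since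
`w` is a function of the types, `Z` is, given the types, a sum of independent centred errors. The
proof therefore splits into a limit theorem for flat directions and a proof that the centralities
are flat, in the sense that every `|w i|` is at most `K / √n` (`IsDelocalized`).

Limit theorem (`ErrorModel.asympStdNormal_tStatistic`). Put `x = w / √v`, where `v = ∑ (w i)² g i (U
i)` is the conditional variance of `Z`. In the characteristic function of `∑ x i * ε i`, the factors
`exp(i t x_k ε_k)` are exchanged one at a time for `exp(-t² x_k² g_k / 2)`. All other factors are
measurable for the σ-algebra `leaveOneOut`, given which `ε k` still has mean zero and variance `g k
(U k)`. Hence the terms of first and second order cancel, and each exchange costs `O(n^(-3/2))`. The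
Gaussian factors multiply to the constant `exp(-t²/2)` because `∑ (x i)² g i = 1`, so no conditional
law is needed. The residual variance differs from `v` by a quantity tending to zero in `L¹`: a
truncation handles `∑ (w i)² ((ε i)² - g i)`, because only third moments of the errors are bounded.
Slutsky's theorem then replaces `v` by the estimator.

Flatness. A second moment bound on the number of links gives `ι'Aι ≥ c p n²` with probability
tending to one. Since the entries of `A` lie in `[0, p]`, Cauchy–Schwarz bounds every entry of `A x`
by `p √n ‖x‖`. On the dense event the norms grow by a factor of at least `c p n`: for a leading
eigenvector because `|λ| ≥ ι'Aι / n`, for the iterates `A^t ι` because their norms are log-convex in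
`t`. The quotient of the two bounds is `1 / (c √n)`. -/

namespace CentralityOLS

/-! ### Centring given all types and the other errors -/

/-- If `ξ` is `m₁`-measurable, `m₁` is independent of `m₂` and `E[ξ | m₀] = 0` for some `m₀ ≤ m₁`,
then `E[ξ | m₀ ⊔ m₂] = 0`. -/
lemma condExp_sup_eq_zero {Ω : Type*} {m₀ m₁ m₂ mΩ : MeasurableSpace Ω} {P : Measure Ω}
    [IsProbabilityMeasure P] (h₀₁ : m₀ ≤ m₁) (hle₁ : m₁ ≤ mΩ) (hle₂ : m₂ ≤ mΩ)
    (hindep : Indep m₁ m₂ P) {ξ : Ω → ℝ} (hξ : Integrable ξ P) (hξm : StronglyMeasurable[m₁] ξ)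
    (h0 : P[ξ | m₀] =ᵐ[P] 0) : P[ξ | m₀ ⊔ m₂] =ᵐ[P] 0 := by
  have hle₀ : m₀ ≤ mΩ := h₀₁.trans hle₁
  have hle : m₀ ⊔ m₂ ≤ mΩ := sup_le hle₀ hle₂
  -- The variable `1_A ξ` is `m₁`-measurable, hence independent of `m₂`. Its conditional expectation
  -- given `m₂` is therefore the constant `E[1_A ξ]`, which vanishes because `A` is in `m₀`.
  have hbase : ∀ A B : Set Ω, MeasurableSet[m₀] A → MeasurableSet[m₂] B →
      ∫ ω in A ∩ B, ξ ω ∂P = 0 := by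
    intro A B hA hB
    have hA' := hle₀ A hA
    have h1 : ∫ ω in A, ξ ω ∂P = 0 := by
      rw [← setIntegral_condExp hle₀ hξ hA, setIntegral_congr_ae (g := fun _ => 0) hA']
      · simp
      · filter_upwards [h0] with ω hω _ using hω
    have h2 := condExp_indep_eq hle₁ hle₂ (hξm.indicator (h₀₁ A hA)) hindep
    rw [integral_indicator hA', h1] at h2
    rw [Set.inter_comm, ← setIntegral_indicator hA',
      ← setIntegral_condExp hle₂ (hξ.indicator hA') hB,
      setIntegral_congr_ae (g := fun _ => 0) (hle₂ B hB)]
    · simp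
    · filter_upwards [h2] with ω hω _ using hω
  set π : Set (Set Ω) := {s | ∃ A B, MeasurableSet[m₀] A ∧ MeasurableSet[m₂] B ∧ s = A ∩ B}
    with hπ
  have hgen : m₀ ⊔ m₂ = MeasurableSpace.generateFrom π := by
    apply le_antisymm
    · refine sup_le (fun A hA => ?_) (fun B hB => ?_)
      · exact MeasurableSpace.measurableSet_generateFrom
          ⟨A, Set.univ, hA, @MeasurableSet.univ _ m₂, by simp⟩
      · exact MeasurableSpace.measurableSet_generateFrom
          ⟨Set.univ, B, @MeasurableSet.univ _ m₀, hB, by simp⟩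
    · refine MeasurableSpace.generateFrom_le ?_
      rintro s ⟨A, B, hA, hB, rfl⟩
      exact @MeasurableSet.inter _ (m₀ ⊔ m₂) _ _ ((le_sup_left : m₀ ≤ m₀ ⊔ m₂) A hA)
        ((le_sup_right : m₂ ≤ m₀ ⊔ m₂) B hB)
  have hpi : IsPiSystem π := by
    rintro _ ⟨A, B, hA, hB, rfl⟩ _ ⟨A', B', hA', hB', rfl⟩ _
    exact ⟨A ∩ A', B ∩ B', @MeasurableSet.inter _ m₀ _ _ hA hA',
      @MeasurableSet.inter _ m₂ _ _ hB hB', Set.inter_inter_inter_comm _ _ _ _⟩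
  have htot : ∫ ω, ξ ω ∂P = 0 := by
    have := hbase Set.univ Set.univ (@MeasurableSet.univ _ m₀) (@MeasurableSet.univ _ m₂)
    simpa using this
  have key : ∀ s, MeasurableSet[m₀ ⊔ m₂] s → ∫ ω in s, ξ ω ∂P = 0 := by
    refine @MeasurableSpace.induction_on_inter _ (m₀ ⊔ m₂) (fun s _ => ∫ ω in s, ξ ω ∂P = 0) π
      hgen hpi (by simp) ?_ ?_ ?_
    · rintro _ ⟨A, B, hA, hB, rfl⟩
      exact hbase A B hA hB
    · intro t ht h
      have := integral_add_compl (hle t ht) hξ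
      linarith
    · intro g hd hg h
      rw [integral_iUnion (fun i => hle _ (hg i)) hd hξ.integrableOn]
      simp [h]
  refine (ae_eq_condExp_of_forall_setIntegral_eq hle hξ (fun s _ _ => integrableOn_zero)
    (fun s hs _ => ?_) stronglyMeasurable_zero.aestronglyMeasurable).symm
  rw [key s hs]; simp

section LeaveOneOut

variable {Ω α : Type*} [MeasurableSpace α]

/-- The σ-algebra generated by all the `U j` and by the errors `ε j` with `j ≠ k`. -/
abbrev leaveOneOut (U : ℕ → Ω → α) (ε : ℕ → Ω → ℝ) (k : ℕ) : MeasurableSpace Ω :=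
  MeasurableSpace.comap (U k) inferInstance ⊔
    ⨆ j ∈ ({k}ᶜ : Set ℕ), MeasurableSpace.comap (fun ω => (U j ω, ε j ω)) inferInstance

variable {U : ℕ → Ω → α} {ε : ℕ → Ω → ℝ}

lemma measurable_leaveOneOut_pair {k j : ℕ} (h : j ≠ k) :
    Measurable[leaveOneOut U ε k] (fun ω => (U j ω, ε j ω)) := by
  have h1 : Measurable[MeasurableSpace.comap (fun ω => (U j ω, ε j ω)) inferInstance]
    (fun ω => (U j ω, ε j ω)) := comap_measurable _
  exact h1.mono ((le_iSup₂_of_le (f := fun j (_ : j ∈ ({k}ᶜ : Set ℕ)) =>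
    MeasurableSpace.comap (fun ω => (U j ω, ε j ω)) inferInstance) j h le_rfl).trans le_sup_right)
    le_rfl

lemma measurable_leaveOneOut_error {k j : ℕ} (h : j ≠ k) :
    Measurable[leaveOneOut U ε k] (ε j) :=
  measurable_snd.comp (measurable_leaveOneOut_pair h)

lemma measurable_leaveOneOut_type (k j : ℕ) : Measurable[leaveOneOut U ε k] (U j) := by
  rcases eq_or_ne j k with rfl | h
  · exact (comap_measurable (U j)).mono le_sup_left le_rfl
  · exact measurable_fst.comp (measurable_leaveOneOut_pair h)

lemma measurable_leaveOneOut_types (n k : ℕ) :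
    Measurable[leaveOneOut U ε k] fun ω (j : Fin n) => U j ω :=
  letI := leaveOneOut U ε k
  measurable_pi_lambda _ fun j => measurable_leaveOneOut_type k j

variable [mΩ : MeasurableSpace Ω] {P : Measure Ω}

lemma leaveOneOut_le (hU : ∀ i, Measurable (U i)) (hε : ∀ i, Measurable (ε i)) (k : ℕ) :
    leaveOneOut U ε k ≤ mΩ :=
  sup_le (hU k).comap_le
    (iSup₂_le fun j _ => ((hU j).prodMk (hε j)).comap_le)

/-- If `ξ` is a function of `(U k, ε k)` with `E[ξ | U k] = 0`, then `ξ` is still centred given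
all the types and the errors other than `ε k`. -/
lemma condExp_leaveOneOut_eq_zero [IsProbabilityMeasure P]
    (hU : ∀ i, Measurable (U i)) (hε : ∀ i, Measurable (ε i))
    (hind : iIndepFun (fun i ω => (U i ω, ε i ω)) P) {k : ℕ} {ξ : Ω → ℝ} (hξ : Integrable ξ P)
    (hξm : Measurable[MeasurableSpace.comap (fun ω => (U k ω, ε k ω)) inferInstance] ξ)
    (h0 : P[ξ | MeasurableSpace.comap (U k) inferInstance] =ᵐ[P] 0) :
    P[ξ | leaveOneOut U ε k] =ᵐ[P] 0 := by
  have hz : ∀ i, Measurable fun ω => (U i ω, ε i ω) := fun i => (hU i).prodMk (hε i)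
  refine condExp_sup_eq_zero (m₁ := MeasurableSpace.comap (fun ω => (U k ω, ε k ω)) inferInstance)
    ?_ (hz k).comap_le (iSup₂_le fun j _ => (hz j).comap_le) ?_ hξ hξm.stronglyMeasurable h0
  · exact (measurable_fst.comp (comap_measurable fun ω => (U k ω, ε k ω))).comap_le
  · have := indep_iSup_of_disjoint (fun i => (hz i).comap_le) hind.iIndep
      (S := {k}) (T := {k}ᶜ) disjoint_compl_right
    simpa using this

/-- Orthogonality of a conditionally centred variable to everything measurable with respect to
the leave-one-out σ-algebra. -/
lemma integral_smul_eq_zero_of_condExp {E : Type*} [NormedAddCommGroup E] [NormedSpace ℝ E]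
    [CompleteSpace E] {m : MeasurableSpace Ω} (hm : m ≤ mΩ) [IsProbabilityMeasure P]
    {ξ : Ω → ℝ} {H : Ω → E} (hξ : Integrable ξ P) (h0 : P[ξ | m] =ᵐ[P] 0)
    (hH : StronglyMeasurable[m] H) (hint : Integrable (fun ω => ξ ω • H ω) P) :
    ∫ ω, ξ ω • H ω ∂P = 0 := by
  rw [← integral_condExp hm]
  have := condExp_smul_of_aestronglyMeasurable_right hξ hint hH.aestronglyMeasurable
  rw [integral_congr_ae (g := fun _ => 0), integral_zero]
  filter_upwards [this, h0] with ω h1 h2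
  have h1' : P[fun ω => ξ ω • H ω | m] ω = (P[ξ | m] • H) ω := h1
  rw [h1', Pi.smul_apply', h2]
  simp

end LeaveOneOut

/-! ### Lindeberg replacement and Taylor bounds -/

/-- Lindeberg replacement: if each factor `a k` can be exchanged for `b k` at cost `r`, whatever
the other factors, then the expected products differ by at most `n r`. -/
lemma norm_integral_prod_sub_integral_prod_le {Ω : Type*} [mΩ : MeasurableSpace Ω]
    {P : Measure Ω} [IsProbabilityMeasure P] {n : ℕ} {a b : Fin n → Ω → ℂ}
    {m : Fin n → MeasurableSpace Ω} {r : ℝ}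
    (ha : ∀ k, Measurable (a k)) (hb : ∀ k, Measurable (b k))
    (ha1 : ∀ k ω, ‖a k ω‖ ≤ 1) (hb1 : ∀ k ω, ‖b k ω‖ ≤ 1)
    (ham : ∀ k j, j ≠ k → Measurable[m k] (a j)) (hbm : ∀ k j, Measurable[m k] (b j))
    (hr : ∀ k, ∀ Q : Ω → ℂ, Measurable[m k] Q → Measurable Q → (∀ ω, ‖Q ω‖ ≤ 1) →
      ‖∫ ω, Q ω * (a k ω - b k ω) ∂P‖ ≤ r) :
    ‖∫ ω, ∏ i, a i ω ∂P - ∫ ω, ∏ i, b i ω ∂P‖ ≤ n * r := by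
  have hprod : ∀ (s : Finset (Fin n)) (c : Fin n → Ω → ℂ), (∀ k ω, ‖c k ω‖ ≤ 1) →
      ∀ ω, ‖∏ i ∈ s, c i ω‖ ≤ 1 := by
    intro s c hc ω
    rw [norm_prod]
    exact Finset.prod_le_one (fun _ _ => norm_nonneg _) (fun i _ => hc i ω)
  have hQ1 : ∀ (s t : Finset (Fin n)) ω, ‖(∏ i ∈ s, a i ω) * ∏ i ∈ t, b i ω‖ ≤ 1 := by
    intro s t ω
    rw [norm_mul]
    exact mul_le_one₀ (hprod s a ha1 ω) (norm_nonneg _) (hprod t b hb1 ω)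
  have hint : ∀ s t : Finset (Fin n),
      Integrable (fun ω => (∏ i ∈ s, a i ω) * ∏ i ∈ t, b i ω) P := by
    intro s t
    refine Integrable.of_bound (by fun_prop) 1 (ae_of_all _ (hQ1 s t))
  -- The hybrids carry `a` on `s` and `b` off `s`. Adding `k` to `s` changes one factor, and the
  -- remaining product contains only `a j` with `j ≠ k` and some `b j`, so it is admissible as `Q`
  -- in `hr`.
  have key : ∀ s : Finset (Fin n),
      ‖∫ ω, (∏ i ∈ s, a i ω) * ∏ i ∈ sᶜ, b i ω ∂P - ∫ ω, ∏ i, b i ω ∂P‖ ≤ s.card * r := by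
    intro s
    induction s using Finset.induction_on with
    | empty => simp
    | insert k s hk ih =>
      have hsplit : ∀ ω, (∏ i ∈ insert k s, a i ω) * ∏ i ∈ (insert k s)ᶜ, b i ω
          - (∏ i ∈ s, a i ω) * ∏ i ∈ sᶜ, b i ω
          = ((∏ i ∈ s, a i ω) * ∏ i ∈ (insert k s)ᶜ, b i ω) * (a k ω - b k ω) := by
        intro ω
        have h1 : sᶜ = insert k (insert k s)ᶜ := by
          ext j; simp only [Finset.mem_compl, Finset.mem_insert]
          by_cases hj : j = k
          · subst hj; simp [hk]
          · simp [hj]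
        rw [Finset.prod_insert hk, h1, Finset.prod_insert (by simp)]
        ring
      have hstep := hr k (fun ω => (∏ i ∈ s, a i ω) * ∏ i ∈ (insert k s)ᶜ, b i ω) ?_
        (by fun_prop) (hQ1 _ _)
      · rw [Finset.card_insert_of_notMem hk]
        have e1 : ∫ ω, (∏ i ∈ insert k s, a i ω) * ∏ i ∈ (insert k s)ᶜ, b i ω ∂P
            - ∫ ω, (∏ i ∈ s, a i ω) * ∏ i ∈ sᶜ, b i ω ∂P
            = ∫ ω, ((∏ i ∈ s, a i ω) * ∏ i ∈ (insert k s)ᶜ, b i ω) * (a k ω - b k ω) ∂P := by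
          rw [← integral_sub (hint _ _) (hint _ _)]
          exact integral_congr_ae (ae_of_all _ hsplit)
        calc _ = ‖(∫ ω, (∏ i ∈ insert k s, a i ω) * ∏ i ∈ (insert k s)ᶜ, b i ω ∂P
            - ∫ ω, (∏ i ∈ s, a i ω) * ∏ i ∈ sᶜ, b i ω ∂P) +
            (∫ ω, (∏ i ∈ s, a i ω) * ∏ i ∈ sᶜ, b i ω ∂P - ∫ ω, ∏ i, b i ω ∂P)‖ := by
              congr 1; ring
          _ ≤ r + s.card * r := by
            refine (norm_add_le _ _).trans (add_le_add ?_ ih)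
            rw [e1]; exact hstep
          _ = _ := by push_cast; ring
      · have h1 : Measurable[m k] fun ω => ∏ i ∈ s, a i ω :=
          Finset.measurable_fun_prod s fun i hi => ham k i (by rintro rfl; exact hk hi)
        have h2 : Measurable[m k] fun ω => ∏ i ∈ (insert k s)ᶜ, b i ω :=
          Finset.measurable_fun_prod _ fun i _ => hbm k i
        exact h1.mul h2
  simpa using key Finset.univ

/-- The cubic remainder is all that is left once mean and variance have been matched. The constant 4
covers both `exp 1` from the series remainder when `|y| ≤ 1` and `1 + 1 + 1 + 1/2` from the triangle
inequality when `|y| ≥ 1`. -/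
lemma norm_exp_mul_I_sub_taylor_le (y : ℝ) :
    ‖Complex.exp (y * Complex.I) - (1 + y * Complex.I - y ^ 2 / 2)‖ ≤ 4 * |y| ^ 3 := by
  rcases le_total |y| 1 with h | h
  · have h1 := Complex.norm_exp_sub_sum_le_norm_mul_exp (y * Complex.I) 3
    have h2 : ‖(y : ℂ) * Complex.I‖ = |y| := by simp
    rw [h2] at h1
    have h3 : ∑ m ∈ Finset.range 3, ((y : ℂ) * Complex.I) ^ m / (m.factorial : ℂ)
        = 1 + y * Complex.I - y ^ 2 / 2 := by
      simp [Finset.sum_range_succ, mul_pow, Nat.factorial]; ring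
    rw [h3] at h1
    have h4 : Real.exp |y| ≤ 4 := by
      have := Real.exp_le_exp.2 h
      have := Real.exp_one_lt_d9
      linarith
    have := mul_le_mul_of_nonneg_left h4 (pow_nonneg (abs_nonneg y) 3)
    linarith
  · have h1 : ‖Complex.exp (y * Complex.I)‖ = 1 := Complex.norm_exp_ofReal_mul_I y
    have h2 : ‖(1 : ℂ) + y * Complex.I - y ^ 2 / 2‖ ≤ 1 + |y| + |y| ^ 2 / 2 := by
      refine (norm_sub_le _ _).trans (add_le_add ((norm_add_le _ _).trans ?_) ?_)
      · simp
      · simp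
    have h3 : |y| ≤ |y| ^ 3 := by nlinarith [mul_nonneg (abs_nonneg y) (abs_nonneg y)]
    have h4 : |y| ^ 2 ≤ |y| ^ 3 := by nlinarith [sq_nonneg |y|]
    refine (norm_sub_le _ _).trans ?_
    rw [h1]
    nlinarith

lemma abs_exp_neg_sub_taylor_le {x : ℝ} (hx : 0 ≤ x) :
    |Real.exp (-x) - (1 - x)| ≤ x ^ 2 := by
  rcases le_total x 1 with h | h
  · have := Real.norm_exp_sub_one_sub_id_le (x := -x) (by simpa [abs_of_nonneg hx] using h)
    simp only [Real.norm_eq_abs, abs_neg, sq_abs] at this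
    convert this using 2; ring
  · have h1 : Real.exp (-x) ≤ 1 := Real.exp_le_one_iff.2 (by linarith)
    have h2 := Real.exp_pos (-x)
    rw [abs_le]; constructor <;> nlinarith

lemma memLp_three_of_integrable {Ω : Type*} [MeasurableSpace Ω] {P : Measure Ω} {X : Ω → ℝ}
    (hX : Measurable X) (h : Integrable (fun ω => |X ω| ^ 3) P) : MemLp X 3 P := by
  rw [← integrable_norm_rpow_iff hX.aestronglyMeasurable (by simp) (by simp)]
  refine h.congr (ae_of_all _ fun ω => ?_)
  simp only [Real.norm_eq_abs]
  norm_num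

/-! ### Characteristic functions of weighted errors -/

/-- Independent pairs `(U i, ε i)` whose errors have conditional mean zero, conditional variance
`g i (U i)` bounded above and below, and uniformly bounded third absolute moments. -/
structure ErrorModel {Ω α : Type*} [MeasurableSpace Ω] [MeasurableSpace α] (P : Measure Ω)
    (U : ℕ → Ω → α) (ε : ℕ → Ω → ℝ) (g : ℕ → α → ℝ) (σlo σhi κ₃ : ℝ) : Prop where
  measurable_type : ∀ i, Measurable (U i)
  measurable_error : ∀ i, Measurable (ε i)
  indep : iIndepFun (fun i ω => (U i ω, ε i ω)) P
  measurable_var : ∀ i, Measurable (g i)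
  σlo_pos : 0 < σlo
  le_var : ∀ i u, σlo ^ 2 ≤ g i u
  var_le : ∀ i u, g i u ≤ σhi ^ 2
  integrable : ∀ i, Integrable (fun ω => |ε i ω| ^ 3) P
  third_moment : ∀ i, ∫ ω, |ε i ω| ^ 3 ∂P ≤ κ₃
  mean_zero : ∀ i, P[ε i | MeasurableSpace.comap (U i) inferInstance] =ᵐ[P] 0
  -- Written as the centring of `ε² - g(U)`, so that the variance enters through the same
  -- orthogonality argument as the mean.
  condVar : ∀ i, P[fun ω => ε i ω ^ 2 - g i (U i ω) |
    MeasurableSpace.comap (U i) inferInstance] =ᵐ[P] 0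

namespace ErrorModel

variable {Ω α : Type*} [mΩ : MeasurableSpace Ω] [MeasurableSpace α] {P : Measure Ω}
  {U : ℕ → Ω → α} {ε : ℕ → Ω → ℝ} {g : ℕ → α → ℝ} {σlo σhi κ₃ : ℝ}

lemma memLp_three (h : ErrorModel P U ε g σlo σhi κ₃) (i : ℕ) : MemLp (ε i) 3 P :=
  memLp_three_of_integrable (h.measurable_error i) (h.integrable i)

lemma var_nonneg (h : ErrorModel P U ε g σlo σhi κ₃) (i : ℕ) (u : α) : 0 ≤ g i u :=
  (sq_nonneg σlo).trans (h.le_var i u)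

variable [IsProbabilityMeasure P]

lemma integrable_error (h : ErrorModel P U ε g σlo σhi κ₃) (i : ℕ) : Integrable (ε i) P :=
  memLp_one_iff_integrable.1 ((h.memLp_three i).mono_exponent (by norm_num))

lemma memLp_two (h : ErrorModel P U ε g σlo σhi κ₃) (i : ℕ) : MemLp (ε i) 2 P :=
  (h.memLp_three i).mono_exponent (by norm_num)

lemma integrable_sq (h : ErrorModel P U ε g σlo σhi κ₃) (i : ℕ) :
    Integrable (fun ω => ε i ω ^ 2) P := (h.memLp_two i).integrable_sq

lemma integrable_var (h : ErrorModel P U ε g σlo σhi κ₃) (i : ℕ) :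
    Integrable (fun ω => g i (U i ω)) P :=
  Integrable.of_bound ((h.measurable_var i).comp (h.measurable_type i)).aestronglyMeasurable
    (σhi ^ 2) (ae_of_all _ fun ω => by
      rw [Real.norm_eq_abs, abs_of_nonneg (h.var_nonneg i _)]; exact h.var_le i _)

lemma integral_sq_le (h : ErrorModel P U ε g σlo σhi κ₃) (i : ℕ) :
    ∫ ω, ε i ω ^ 2 ∂P ≤ σhi ^ 2 := by
  have h0 : ∫ ω, (ε i ω ^ 2 - g i (U i ω)) ∂P = 0 := by
    rw [← integral_condExp (h.measurable_type i).comap_le, integral_congr_ae (h.condVar i)]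
    simp
  rw [integral_sub (h.integrable_sq i) (h.integrable_var i)] at h0
  have : ∫ ω, g i (U i ω) ∂P ≤ ∫ _, σhi ^ 2 ∂P :=
    integral_mono (h.integrable_var i) (integrable_const _) fun ω => h.var_le i _
  simp at this
  linarith

lemma condExp_error (h : ErrorModel P U ε g σlo σhi κ₃) (i : ℕ) :
    P[ε i | leaveOneOut U ε i] =ᵐ[P] 0 :=
  condExp_leaveOneOut_eq_zero h.measurable_type h.measurable_error h.indep (h.integrable_error i)
    (measurable_snd.comp (comap_measurable fun ω => (U i ω, ε i ω))) (h.mean_zero i)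

lemma condExp_sq_sub_var (h : ErrorModel P U ε g σlo σhi κ₃) (i : ℕ) :
    P[fun ω => ε i ω ^ 2 - g i (U i ω) | leaveOneOut U ε i] =ᵐ[P] 0 := by
  refine condExp_leaveOneOut_eq_zero h.measurable_type h.measurable_error h.indep
    ((h.integrable_sq i).sub (h.integrable_var i)) ?_ (h.condVar i)
  have hz : Measurable[MeasurableSpace.comap (fun ω => (U i ω, ε i ω)) inferInstance]
      (fun ω => (U i ω, ε i ω)) := comap_measurable _
  have : Measurable fun z : α × ℝ => z.2 ^ 2 - g i z.1 :=
    (measurable_snd.pow_const 2).sub ((h.measurable_var i).comp measurable_fst)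
  exact this.comp hz

/-- Replacing `exp (iτε)` by the Gaussian factor `exp (-τ²g(U)/2)`. -/
lemma norm_integral_mul_sub_le (h : ErrorModel P U ε g σlo σhi κ₃) (k : ℕ) {τ : Ω → ℝ} {b : ℝ}
    (hτ : Measurable[leaveOneOut U ε k] τ) (hτb : ∀ ω, |τ ω| ≤ b) {Q : Ω → ℂ}
    (hQ : Measurable[leaveOneOut U ε k] Q) (hQ1 : ∀ ω, ‖Q ω‖ ≤ 1) :
    ‖∫ ω, Q ω * (Complex.exp ((τ ω * ε k ω : ℝ) * Complex.I)
      - (Real.exp (-(τ ω ^ 2 * g k (U k ω) / 2)) : ℝ)) ∂P‖ ≤ 4 * b ^ 3 * κ₃ + b ^ 4 * σhi ^ 4 := by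
  have hle := leaveOneOut_le h.measurable_type h.measurable_error k
  have hτ' : Measurable τ := hτ.mono hle le_rfl
  have hQ' : Measurable Q := hQ.mono hle le_rfl
  have hU := h.measurable_type k
  have hε := h.measurable_error k
  have hg := (h.measurable_var k).comp hU
  have hb : 0 ≤ b := by
    obtain ⟨ω⟩ := nonempty_of_isProbabilityMeasure P
    exact (abs_nonneg _).trans (hτb ω)
  -- To second order, `exp(iτε) - exp(-τ²g/2)` is `iτ ε - (τ²/2)(ε² - g)`. `H1` and `H2` are `Q`
  -- times these two coefficients. Both are leave-one-out measurable, so both terms integrate to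
  -- zero and may be subtracted freely.
  set H1 : Ω → ℂ := fun ω => Q ω * (τ ω * Complex.I) with hH1
  set H2 : Ω → ℂ := fun ω => Q ω * (-(τ ω : ℂ) ^ 2 / 2) with hH2
  have hH1m : Measurable[leaveOneOut U ε k] H1 :=
    hQ.mul ((Complex.measurable_ofReal.comp hτ).mul measurable_const)
  have hH2m : Measurable[leaveOneOut U ε k] H2 :=
    hQ.mul ((((Complex.measurable_ofReal.comp hτ).pow_const 2).neg).div_const 2)
  have hH1b : ∀ ω, ‖H1 ω‖ ≤ b := by
    intro ω
    simp only [hH1, norm_mul, Complex.norm_I, mul_one, Complex.norm_real, Real.norm_eq_abs]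
    nlinarith [hQ1 ω, hτb ω, norm_nonneg (Q ω), abs_nonneg (τ ω)]
  have hH2b : ∀ ω, ‖H2 ω‖ ≤ b ^ 2 := by
    intro ω
    have h1 : |τ ω| ^ 2 ≤ b ^ 2 := pow_le_pow_left₀ (abs_nonneg _) (hτb ω) 2
    simp only [hH2, norm_mul, norm_div, norm_neg, norm_pow, Complex.norm_real, Real.norm_eq_abs]
    norm_num
    simp only [sq_abs] at h1
    nlinarith [hQ1 ω, norm_nonneg (Q ω), sq_nonneg (τ ω)]
  have hi1 : Integrable (fun ω => ε k ω • H1 ω) P :=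
    (h.integrable_error k).smul_bdd b (hH1m.mono hle le_rfl).aestronglyMeasurable
      (ae_of_all _ hH1b)
  have hv := (h.integrable_sq k).sub (h.integrable_var k)
  have hi2 : Integrable (fun ω => (ε k ω ^ 2 - g k (U k ω)) • H2 ω) P :=
    hv.smul_bdd (b ^ 2) (hH2m.mono hle le_rfl).aestronglyMeasurable
      (ae_of_all _ hH2b)
  have e1 := integral_smul_eq_zero_of_condExp hle (h.integrable_error k) (h.condExp_error k)
    hH1m.stronglyMeasurable hi1
  have e2 := integral_smul_eq_zero_of_condExp hle hv (h.condExp_sq_sub_var k)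
    hH2m.stronglyMeasurable hi2
  set F : Ω → ℂ := fun ω => Q ω * (Complex.exp ((τ ω * ε k ω : ℝ) * Complex.I)
      - (Real.exp (-(τ ω ^ 2 * g k (U k ω) / 2)) : ℝ)) with hF
  have hFi : Integrable F P := by
    refine Integrable.of_bound ?_ 2 (ae_of_all _ fun ω => ?_)
    · have : Measurable F := by
        have h1 : Measurable fun ω => ((τ ω * ε k ω : ℝ) : ℂ) * Complex.I :=
          (Complex.measurable_ofReal.comp (hτ'.mul hε)).mul_const _
        have h2 : Measurable fun ω => -(τ ω ^ 2 * g k (U k ω) / 2) :=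
          (((hτ'.pow_const 2).mul hg).div_const 2).neg
        exact hQ'.mul ((Complex.measurable_exp.comp h1).sub
          (Complex.measurable_ofReal.comp (Real.measurable_exp.comp h2)))
      exact this.aestronglyMeasurable
    · simp only [hF, norm_mul]
      have h1 : ‖Complex.exp ((τ ω * ε k ω : ℝ) * Complex.I)‖ = 1 :=
        Complex.norm_exp_ofReal_mul_I _
      have h2 : ‖((Real.exp (-(τ ω ^ 2 * g k (U k ω) / 2)) : ℝ) : ℂ)‖ ≤ 1 := by
        rw [Complex.norm_real, Real.norm_eq_abs, abs_of_pos (Real.exp_pos _)]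
        refine Real.exp_le_one_iff.2 ?_
        have := mul_nonneg (sq_nonneg (τ ω)) (h.var_nonneg k (U k ω))
        linarith
      have h3 := norm_sub_le (Complex.exp ((τ ω * ε k ω : ℝ) * Complex.I))
        ((Real.exp (-(τ ω ^ 2 * g k (U k ω) / 2)) : ℝ) : ℂ)
      have := mul_le_mul (hQ1 ω) (h3.trans (add_le_add h1.le h2)) (norm_nonneg _) zero_le_one
      linarith
  have hsub : ∫ ω, F ω ∂P = ∫ ω, (F ω - ε k ω • H1 ω - (ε k ω ^ 2 - g k (U k ω)) • H2 ω) ∂P := by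
    have e3 := integral_sub (hFi.sub hi1) hi2
    have e4 := integral_sub hFi hi1
    simp only [Pi.sub_apply] at e2 e3 e4
    rw [e3, e4, e1, e2]; simp
  rw [hsub]
  have hpt : ∀ ω, ‖F ω - ε k ω • H1 ω - (ε k ω ^ 2 - g k (U k ω)) • H2 ω‖
      ≤ 4 * b ^ 3 * |ε k ω| ^ 3 + b ^ 4 * σhi ^ 4 := by
    intro ω
    set y := τ ω * ε k ω with hy
    set x := τ ω ^ 2 * g k (U k ω) / 2 with hx
    have hx0 : 0 ≤ x := by
      have := mul_nonneg (sq_nonneg (τ ω)) (h.var_nonneg k (U k ω))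
      rw [hx]; linarith
    have hid : F ω - ε k ω • H1 ω - (ε k ω ^ 2 - g k (U k ω)) • H2 ω
        = Q ω * ((Complex.exp (y * Complex.I) - (1 + y * Complex.I - y ^ 2 / 2))
          - ((Real.exp (-x) - (1 - x) : ℝ) : ℂ)) := by
      simp only [hF, hH1, hH2, hy, hx, Complex.real_smul]
      push_cast
      ring
    rw [hid, norm_mul]
    have hA := norm_exp_mul_I_sub_taylor_le y
    have hB := abs_exp_neg_sub_taylor_le hx0
    have hA' : |y| ^ 3 ≤ b ^ 3 * |ε k ω| ^ 3 := by
      rw [hy, abs_mul, mul_pow]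
      exact mul_le_mul_of_nonneg_right (pow_le_pow_left₀ (abs_nonneg _) (hτb ω) 3) (by positivity)
    have hB' : x ^ 2 ≤ b ^ 4 * σhi ^ 4 := by
      have h1 : τ ω ^ 2 ≤ b ^ 2 := by
        rw [← sq_abs]; exact pow_le_pow_left₀ (abs_nonneg _) (hτb ω) 2
      have h2 : x ≤ b ^ 2 * σhi ^ 2 := by
        have := mul_le_mul h1 (h.var_le k (U k ω)) (h.var_nonneg k _) (sq_nonneg b)
        rw [hx]
        nlinarith [mul_nonneg (sq_nonneg (τ ω)) (h.var_nonneg k (U k ω))]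
      calc x ^ 2 ≤ (b ^ 2 * σhi ^ 2) ^ 2 := pow_le_pow_left₀ hx0 h2 2
        _ = _ := by ring
    have hC : ‖((Real.exp (-x) - (1 - x) : ℝ) : ℂ)‖ ≤ b ^ 4 * σhi ^ 4 := by
      rw [Complex.norm_real]; exact hB.trans hB'
    have hD := (norm_sub_le (Complex.exp (y * Complex.I) - (1 + y * Complex.I - y ^ 2 / 2))
      ((Real.exp (-x) - (1 - x) : ℝ) : ℂ)).trans (add_le_add hA hC)
    have := mul_le_mul (hQ1 ω) hD (norm_nonneg _) zero_le_one
    linarith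
  have hbi : Integrable (fun ω => 4 * b ^ 3 * |ε k ω| ^ 3 + b ^ 4 * σhi ^ 4) P :=
    ((h.integrable k).const_mul _).add (integrable_const _)
  calc _ ≤ ∫ ω, (4 * b ^ 3 * |ε k ω| ^ 3 + b ^ 4 * σhi ^ 4) ∂P :=
        norm_integral_le_of_norm_le hbi (ae_of_all _ hpt)
    _ = 4 * b ^ 3 * ∫ ω, |ε k ω| ^ 3 ∂P + b ^ 4 * σhi ^ 4 := by
        rw [integral_add ((h.integrable k).const_mul _) (integrable_const _),
          integral_const_mul]
        simp
    _ ≤ _ := by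
        have := mul_le_mul_of_nonneg_left (h.third_moment k) (by positivity : 0 ≤ 4 * b ^ 3)
        linarith

/-- Characteristic function of a sum of errors with type-dependent standardised weights. -/
lemma norm_integral_exp_sub_le (h : ErrorModel P U ε g σlo σhi κ₃) {n : ℕ}
    {x : (Fin n → α) → Fin n → ℝ} (hx : Measurable x) {b : ℝ} (hxb : ∀ u i, |x u i| ≤ b)
    (hx1 : ∀ u, ∑ i, x u i ^ 2 * g i (u i) = 1) (t : ℝ) :
    ‖∫ ω, Complex.exp ((t * ∑ i, x (fun j => U j ω) i * ε i ω : ℝ) * Complex.I) ∂P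
      - (Real.exp (-(t ^ 2 / 2)) : ℝ)‖
      ≤ n * (4 * (|t| * b) ^ 3 * κ₃ + (|t| * b) ^ 4 * σhi ^ 4) := by
  set u : Ω → Fin n → α := fun ω j => U j ω with hu
  have hum : ∀ k, Measurable[leaveOneOut U ε k] u := fun k =>
    measurable_leaveOneOut_types n k
  have hle := leaveOneOut_le h.measurable_type h.measurable_error
  have hτ : ∀ k : ℕ, ∀ i, Measurable[leaveOneOut U ε k] fun ω => t * x (u ω) i := fun k i =>
    (((measurable_pi_apply i).comp hx).comp (hum k)).const_mul t
  set a : Fin n → Ω → ℂ := fun i ω =>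
    Complex.exp ((t * x (u ω) i * ε i ω : ℝ) * Complex.I) with ha
  set c : Fin n → Ω → ℂ := fun i ω =>
    ((Real.exp (-((t * x (u ω) i) ^ 2 * g i (U i ω) / 2)) : ℝ) : ℂ) with hc
  have ham : ∀ k j : Fin n, j ≠ k → Measurable[leaveOneOut U ε k] (a j) := by
    intro k j hjk
    have h1 : Measurable[leaveOneOut U ε k] (ε j) :=
      measurable_leaveOneOut_error (fun e => hjk (Fin.ext e))
    exact Complex.measurable_exp.comp ((Complex.measurable_ofReal.comp
      ((hτ k j).mul h1)).mul_const _)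
  have hcm : ∀ k j : Fin n, Measurable[leaveOneOut U ε k] (c j) := by
    intro k j
    have h1 : Measurable[leaveOneOut U ε k] fun ω => g j (U j ω) :=
      (h.measurable_var j).comp (measurable_leaveOneOut_type k j)
    exact Complex.measurable_ofReal.comp (Real.measurable_exp.comp
      (((((hτ k j).pow_const 2).mul h1).div_const 2).neg))
  have ha' : ∀ k, Measurable (a k) := fun k =>
    Complex.measurable_exp.comp ((Complex.measurable_ofReal.comp
      (((hτ k k).mono (hle k) le_rfl).mul (h.measurable_error k))).mul_const _)
  have hmain := norm_integral_prod_sub_integral_prod_le (P := P) (a := a) (b := c)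
    (m := fun k => leaveOneOut U ε k)
    (r := 4 * (|t| * b) ^ 3 * κ₃ + (|t| * b) ^ 4 * σhi ^ 4)
    ha' (fun k => (hcm k k).mono (hle k) le_rfl)
    (fun k ω => (Complex.norm_exp_ofReal_mul_I _).le)
    (fun k ω => by
      simp only [hc]
      rw [Complex.norm_real, Real.norm_eq_abs, abs_of_pos (Real.exp_pos _)]
      refine Real.exp_le_one_iff.2 ?_
      have := mul_nonneg (sq_nonneg (t * x (u ω) k)) (h.var_nonneg k (U k ω))
      linarith) ham hcm
    (fun k Q hQ _ hQ1 => h.norm_integral_mul_sub_le k (hτ k k) (fun ω => by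
      rw [abs_mul]
      exact mul_le_mul_of_nonneg_left (hxb _ _) (abs_nonneg t)) hQ hQ1)
  have e1 : ∀ ω, ∏ i, a i ω
      = Complex.exp ((t * ∑ i, x (u ω) i * ε i ω : ℝ) * Complex.I) := by
    intro ω
    simp only [ha]
    rw [← Complex.exp_sum, ← Finset.sum_mul, ← Complex.ofReal_sum, Finset.mul_sum]
    simp only [mul_assoc]
  -- The standardisation `hx1` makes this product of random Gaussian factors a constant.
  have e2 : ∀ ω, ∏ i, c i ω = (Real.exp (-(t ^ 2 / 2)) : ℝ) := by
    intro ω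
    simp only [hc]
    rw [← Complex.ofReal_prod, ← Real.exp_sum, Finset.sum_neg_distrib]
    congr 3
    have := hx1 (u ω)
    calc ∑ i, (t * x (u ω) i) ^ 2 * g i (U i ω) / 2
        = t ^ 2 / 2 * ∑ i, x (u ω) i ^ 2 * g i (u ω i) := by
          rw [Finset.mul_sum]; refine Finset.sum_congr rfl fun i _ => ?_
          simp only [hu]; ring
      _ = _ := by rw [this, mul_one]
  simp only [e1, e2] at hmain
  simpa using hmain

end ErrorModel

/-! ### `L¹` bounds for the residual variance -/

namespace ErrorModel

variable {Ω α : Type*} [mΩ : MeasurableSpace Ω] [MeasurableSpace α] {P : Measure Ω}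
  {U : ℕ → Ω → α} {ε : ℕ → Ω → ℝ} {g : ℕ → α → ℝ} {σlo σhi κ₃ : ℝ}

lemma measurable_types (h : ErrorModel P U ε g σlo σhi κ₃) (n : ℕ) :
    Measurable fun ω (j : Fin n) => U j ω :=
  measurable_pi_lambda _ fun j => h.measurable_type j

lemma measurable_coef (h : ErrorModel P U ε g σlo σhi κ₃) {n : ℕ}
    {c : (Fin n → α) → Fin n → ℝ} (hc : Measurable c) (i : Fin n) :
    Measurable fun ω => c (fun j => U j ω) i :=
  ((measurable_pi_apply i).comp hc).comp (h.measurable_types n)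

variable [IsProbabilityMeasure P]

lemma memLp_coef_mul (h : ErrorModel P U ε g σlo σhi κ₃) {n : ℕ}
    {c : (Fin n → α) → Fin n → ℝ} (hc : Measurable c) {b : ℝ} (hcb : ∀ u i, |c u i| ≤ b)
    {p : ENNReal} {ξ : Fin n → Ω → ℝ} (hξ : ∀ i, MemLp (ξ i) p P) (i : Fin n) :
    MemLp (fun ω => c (fun j => U j ω) i * ξ i ω) p P := by
  have h1 : MemLp (fun ω => c (fun j => U j ω) i) ⊤ P :=
    MemLp.of_bound (h.measurable_coef hc i).aestronglyMeasurable b (ae_of_all _ fun ω => hcb _ i)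
  exact (hξ i).mul h1

lemma memLp_sum (h : ErrorModel P U ε g σlo σhi κ₃) {n : ℕ}
    {c : (Fin n → α) → Fin n → ℝ} (hc : Measurable c) {b : ℝ} (hcb : ∀ u i, |c u i| ≤ b)
    {p : ENNReal} {ξ : Fin n → Ω → ℝ} (hξ : ∀ i, MemLp (ξ i) p P) :
    MemLp (fun ω => ∑ i, c (fun j => U j ω) i * ξ i ω) p P :=
  memLp_finsetSum _ fun i _ => h.memLp_coef_mul hc hcb hξ i

/-- Variance bound for sums of conditionally centred variables with type-dependent weights. -/
lemma integral_sq_sum_le (h : ErrorModel P U ε g σlo σhi κ₃) {n : ℕ}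
    {c : (Fin n → α) → Fin n → ℝ} (hc : Measurable c) {b : ℝ} (hcb : ∀ u i, |c u i| ≤ b)
    {ξ : Fin n → Ω → ℝ} (hξ : ∀ i, MemLp (ξ i) 2 P)
    (hξm : ∀ i : Fin n,
      Measurable[MeasurableSpace.comap (fun ω => (U i ω, ε i ω)) inferInstance] (ξ i))
    (h0 : ∀ i : Fin n, P[ξ i | MeasurableSpace.comap (U i) inferInstance] =ᵐ[P] 0)
    {B : ℝ} (hB : ∀ i, ∫ ω, ξ i ω ^ 2 ∂P ≤ B) :
    ∫ ω, (∑ i, c (fun j => U j ω) i * ξ i ω) ^ 2 ∂P ≤ n * (b ^ 2 * B) := by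
  set d : Fin n → Ω → ℝ := fun i ω => c (fun j => U j ω) i with hd
  have hL := h.memLp_coef_mul hc hcb hξ
  have hint : ∀ i j, Integrable (fun ω => (d i ω * ξ i ω) * (d j ω * ξ j ω)) P :=
    fun i j => (hL i).integrable_mul (hL j)
  have hsq : ∀ ω, (∑ i, d i ω * ξ i ω) ^ 2
      = ∑ i, ∑ j, (d i ω * ξ i ω) * (d j ω * ξ j ω) := by
    intro ω; rw [sq, Finset.sum_mul_sum]
  have hle := leaveOneOut_le h.measurable_type h.measurable_error
  -- All weights and `ξ j` are measurable for the leave-one-out σ-algebra of `i`, given which `ξ i`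
  -- is centred.
  have hoff : ∀ i j, i ≠ j → ∫ ω, (d i ω * ξ i ω) * (d j ω * ξ j ω) ∂P = 0 := by
    intro i j hij
    have hdm : ∀ l, Measurable[leaveOneOut U ε i] (d l) := fun l =>
      ((measurable_pi_apply l).comp hc).comp (measurable_leaveOneOut_types n i)
    have hξj : Measurable[leaveOneOut U ε i] (ξ j) := by
      refine (hξm j).mono ?_ le_rfl
      exact (measurable_leaveOneOut_pair (fun e => hij (Fin.ext e.symm))).comap_le
    have hH : Measurable[leaveOneOut U ε i] fun ω => d i ω * (d j ω * ξ j ω) :=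
      (hdm i).mul ((hdm j).mul hξj)
    have e : ∀ ω, (d i ω * ξ i ω) * (d j ω * ξ j ω)
        = ξ i ω • (d i ω * (d j ω * ξ j ω)) := by intro ω; rw [smul_eq_mul]; ring
    have hi := hint i j
    simp only [e] at hi ⊢
    have hξi := (hξ i).integrable (by norm_num)
    exact integral_smul_eq_zero_of_condExp (hle i) hξi
      (condExp_leaveOneOut_eq_zero h.measurable_type h.measurable_error h.indep hξi (hξm i) (h0 i))
      hH.stronglyMeasurable hi
  have hdiag : ∀ i, ∫ ω, (d i ω * ξ i ω) * (d i ω * ξ i ω) ∂P ≤ b ^ 2 * B := by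
    intro i
    calc _ ≤ ∫ ω, b ^ 2 * ξ i ω ^ 2 ∂P := by
          refine integral_mono (hint i i) ((hξ i).integrable_sq.const_mul _) fun ω => ?_
          have : d i ω ^ 2 ≤ b ^ 2 := by
            rw [← sq_abs]; exact pow_le_pow_left₀ (abs_nonneg _) (hcb _ i) 2
          calc (d i ω * ξ i ω) * (d i ω * ξ i ω) = d i ω ^ 2 * ξ i ω ^ 2 := by ring
            _ ≤ _ := mul_le_mul_of_nonneg_right this (sq_nonneg _)
      _ ≤ _ := by
          rw [integral_const_mul]
          exact mul_le_mul_of_nonneg_left (hB i) (sq_nonneg b)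
  have hsq' : ∫ ω, (∑ i, d i ω * ξ i ω) ^ 2 ∂P
      = ∑ i, ∑ j, ∫ ω, (d i ω * ξ i ω) * (d j ω * ξ j ω) ∂P := by
    simp only [hsq]
    rw [integral_finsetSum _ fun i _ => integrable_finsetSum _ fun j _ => hint i j]
    exact Finset.sum_congr rfl fun i _ => integral_finsetSum _ fun j _ => hint i j
  rw [hsq']
  calc _ ≤ ∑ _i : Fin n, b ^ 2 * B := by
        refine Finset.sum_le_sum fun i _ => ?_
        rw [Finset.sum_eq_single i (fun j _ hj => hoff i j hj.symm) (by simp)]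
        exact hdiag i
    _ = _ := by simp

/-- Truncated conditional law of large numbers for the squared errors. -/
lemma integral_abs_sum_sq_sub_var_le (h : ErrorModel P U ε g σlo σhi κ₃) {n : ℕ}
    {c : (Fin n → α) → Fin n → ℝ} (hc : Measurable c) {b : ℝ} (hcb : ∀ u i, |c u i| ≤ b)
    {M : ℝ} (hM : 0 < M) :
    ∫ ω, |∑ i, c (fun j => U j ω) i * (ε i ω ^ 2 - g i (U i ω))| ∂P
      ≤ 1 / M + n * b ^ 2 * M ^ 5 + n * b * (2 * κ₃ / M) := by
  -- With only third moments of `ε` available, `ε²` need not be square integrable. The truncated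
  -- part `η`, recentred given `U i` to form `ξ`, is bounded and admits a variance bound. The tail
  -- `ζ` is at most `|ε|³ / M`.
  set η : Fin n → Ω → ℝ := fun i ω => if |ε i ω| ≤ M then ε i ω ^ 2 else 0 with hη
  set ζ : Fin n → Ω → ℝ := fun i ω => ε i ω ^ 2 - η i ω with hζ
  let mU : Fin n → MeasurableSpace Ω := fun i => MeasurableSpace.comap (U i) inferInstance
  have hmU : ∀ i, mU i ≤ mΩ := fun i => (h.measurable_type i).comap_le
  set ξ : Fin n → Ω → ℝ := fun i => η i - P[η i | mU i] with hξ
  have hφ : Measurable fun x : ℝ => if |x| ≤ M then x ^ 2 else 0 :=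
    Measurable.ite (measurableSet_le measurable_abs measurable_const)
      (measurable_id.pow_const 2) measurable_const
  have hηm : ∀ i, Measurable (η i) := fun i => hφ.comp (h.measurable_error i)
  have hη0 : ∀ i ω, 0 ≤ η i ω := by
    intro i ω; simp only [hη]; split_ifs <;> positivity
  have hηM : ∀ i ω, η i ω ≤ M ^ 2 := by
    intro i ω; simp only [hη]; split_ifs with h1
    · rw [← sq_abs]; exact pow_le_pow_left₀ (abs_nonneg _) h1 2
    · positivity
  have hηi : ∀ i, Integrable (η i) P := fun i =>
    Integrable.of_bound (hηm i).aestronglyMeasurable (M ^ 2) (ae_of_all _ fun ω => by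
      rw [Real.norm_eq_abs, abs_of_nonneg (hη0 i ω)]; exact hηM i ω)
  have hζi : ∀ i, Integrable (ζ i) P := fun i => (h.integrable_sq i).sub (hηi i)
  have hζb : ∀ i ω, |ζ i ω| ≤ |ε i ω| ^ 3 / M := by
    intro i ω
    simp only [hζ, hη]
    split_ifs with h1
    · simp; positivity
    · rw [sub_zero, abs_of_nonneg (sq_nonneg _), le_div_iff₀ hM, ← sq_abs, pow_succ _ 2]
      exact mul_le_mul_of_nonneg_left (not_le.1 h1).le (by positivity)
  have hξM : ∀ i, ∀ᵐ ω ∂P, |ξ i ω| ≤ M ^ 2 := by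
    intro i
    have h1 : 0 ≤ᵐ[P] P[η i | mU i] := condExp_nonneg (ae_of_all _ (hη0 i))
    have h2 : P[η i | mU i] ≤ᵐ[P] P[fun _ => M ^ 2 | mU i] :=
      condExp_mono (hηi i) (integrable_const _) (ae_of_all _ (hηM i))
    rw [condExp_const (hmU i)] at h2
    filter_upwards [h1, h2] with ω h1 h2
    simp only [hξ, Pi.sub_apply, Pi.zero_apply] at h1 ⊢
    rw [abs_le]
    constructor <;> linarith [hη0 i ω, hηM i ω]
  have hcm : ∀ i, Measurable (P[η i | mU i]) := fun i =>
    stronglyMeasurable_condExp.measurable.mono (hmU i) le_rfl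
  have hξm : ∀ i, Measurable (ξ i) := fun i => (hηm i).sub (hcm i)
  have hξL : ∀ i, MemLp (ξ i) 2 P := fun i =>
    MemLp.of_bound (hξm i).aestronglyMeasurable (M ^ 2) (hξM i)
  have hξz : ∀ i : Fin n,
      Measurable[MeasurableSpace.comap (fun ω => (U i ω, ε i ω)) inferInstance] (ξ i) := by
    intro i
    have hz : Measurable[MeasurableSpace.comap (fun ω => (U i ω, ε i ω)) inferInstance]
      (fun ω => (U i ω, ε i ω)) := comap_measurable _
    have h1 : Measurable[MeasurableSpace.comap (fun ω => (U i ω, ε i ω)) inferInstance] (η i) :=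
      hφ.comp (measurable_snd.comp hz)
    have h2 : Measurable[MeasurableSpace.comap (fun ω => (U i ω, ε i ω)) inferInstance]
        (P[η i | mU i]) :=
      stronglyMeasurable_condExp.measurable.mono (measurable_fst.comp hz).comap_le le_rfl
    exact h1.sub h2
  have hξ0 : ∀ i : Fin n, P[ξ i | MeasurableSpace.comap (U i) inferInstance] =ᵐ[P] 0 := by
    intro i
    have h1 := condExp_sub (hηi i) integrable_condExp (mU i) (f := η i) (g := P[η i | mU i])
    rw [condExp_of_stronglyMeasurable (hmU i) stronglyMeasurable_condExp integrable_condExp] at h1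
    simpa using h1
  have hB : ∀ i, ∫ ω, ξ i ω ^ 2 ∂P ≤ M ^ 4 := by
    intro i
    have : ∫ ω, ξ i ω ^ 2 ∂P ≤ ∫ _, M ^ 4 ∂P := by
      refine integral_mono_ae (hξL i).integrable_sq (integrable_const _) ?_
      filter_upwards [hξM i] with ω hω
      rw [← sq_abs]
      calc |ξ i ω| ^ 2 ≤ (M ^ 2) ^ 2 := pow_le_pow_left₀ (abs_nonneg _) hω 2
        _ = M ^ 4 := by ring
    simpa using this
  have hmain := h.integral_sq_sum_le hc hcb hξL hξz hξ0 hB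
  set ρ : Fin n → Ω → ℝ := fun i ω => (ε i ω ^ 2 - g i (U i ω)) - ξ i ω with hρ
  have hξi : ∀ i, Integrable (ξ i) P := fun i => (hξL i).integrable (by norm_num)
  have hρi : ∀ i, Integrable (ρ i) P := fun i =>
    ((h.integrable_sq i).sub (h.integrable_var i)).sub (hξi i)
  -- Since `E[ε² | U] = g(U)`, recentring `η` differs from recentring `ε²` by exactly the recentred
  -- tail.
  have hρeq : ∀ i : Fin n, ρ i =ᵐ[P] ζ i - P[ζ i | mU i] := by
    intro i
    have hgm : StronglyMeasurable[mU i] fun ω => g i (U i ω) :=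
      ((h.measurable_var i).comp (comap_measurable (U i))).stronglyMeasurable
    have e1 : ζ i = ((fun ω => ε i ω ^ 2 - g i (U i ω)) + fun ω => g i (U i ω)) - η i := by
      ext ω; simp [hζ]
    have i1 : Integrable (fun ω => ε i ω ^ 2 - g i (U i ω)) P :=
      (h.integrable_sq i).sub (h.integrable_var i)
    have h1 := condExp_sub (i1.add (h.integrable_var i)) (hηi i) (mU i)
    have h2 := condExp_add i1 (h.integrable_var i) (mU i)
    rw [condExp_of_stronglyMeasurable (hmU i) hgm (h.integrable_var i)] at h2
    rw [← e1] at h1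
    filter_upwards [h1, h2, h.condVar i] with ω h1 h2 h3
    have h3' : P[fun ω => ε i ω ^ 2 - g i (U i ω) | mU i] ω = 0 := h3
    simp only [Pi.sub_apply, Pi.add_apply] at h1 h2 ⊢
    rw [h1, h2, h3']
    simp only [hρ, hξ, hζ, Pi.sub_apply]
    ring
  have hρb : ∀ i, ∫ ω, |ρ i ω| ∂P ≤ 2 * κ₃ / M := by
    intro i
    have h1 : ∫ ω, |ζ i ω| ∂P ≤ κ₃ / M := by
      calc _ ≤ ∫ ω, |ε i ω| ^ 3 / M ∂P :=
            integral_mono (hζi i).abs ((h.integrable i).div_const M) (hζb i)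
        _ ≤ _ := by
            rw [integral_div]; exact div_le_div_of_nonneg_right (h.third_moment i) hM.le
    have h2 : ∫ ω, |P[ζ i | mU i] ω| ∂P ≤ ∫ ω, |ζ i ω| ∂P := integral_abs_condExp_le _
    calc ∫ ω, |ρ i ω| ∂P ≤ ∫ ω, (|ζ i ω| + |P[ζ i | mU i] ω|) ∂P := by
          refine integral_mono_ae (hρi i).abs ((hζi i).abs.add integrable_condExp.abs) ?_
          filter_upwards [hρeq i] with ω hω
          rw [hω]; exact abs_sub _ _
      _ = ∫ ω, |ζ i ω| ∂P + ∫ ω, |P[ζ i | mU i] ω| ∂P :=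
          integral_add (hζi i).abs integrable_condExp.abs
      _ ≤ _ := by rw [mul_div_assoc]; linarith
  have hL := h.memLp_sum hc hcb hξL
  have hpt : ∀ ω, |∑ i, c (fun j => U j ω) i * (ε i ω ^ 2 - g i (U i ω))|
      ≤ (1 / M + M * (∑ i, c (fun j => U j ω) i * ξ i ω) ^ 2) + ∑ i, b * |ρ i ω| := by
    intro ω
    have e : ∑ i, c (fun j => U j ω) i * (ε i ω ^ 2 - g i (U i ω))
        = (∑ i, c (fun j => U j ω) i * ξ i ω) + ∑ i, c (fun j => U j ω) i * ρ i ω := by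
      rw [← Finset.sum_add_distrib]
      refine Finset.sum_congr rfl fun i _ => ?_
      simp only [hρ]; ring
    rw [e]
    refine (abs_add_le _ _).trans (add_le_add ?_ ?_)
    · set y := ∑ i, c (fun j => U j ω) i * ξ i ω
      -- This gives `2|y| ≤ 1 / M + M y²`, which converts the second moment bound into an `L¹`
      -- bound.
      have h1 : 0 ≤ M * (|y| - 1 / M) ^ 2 := by positivity
      have h2 : M * (|y| - 1 / M) ^ 2 = M * |y| ^ 2 - 2 * |y| + 1 / M := by
        field_simp; ring
      rw [h2, sq_abs] at h1
      have := abs_nonneg y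
      linarith
    · refine (Finset.abs_sum_le_sum_abs _ _).trans (Finset.sum_le_sum fun i _ => ?_)
      rw [abs_mul]
      exact mul_le_mul_of_nonneg_right (hcb _ i) (abs_nonneg _)
  have hci : Integrable (fun ω => ∑ i : Fin n, b * |ρ i ω|) P :=
    integrable_finsetSum _ fun i _ => (hρi i).abs.const_mul b
  have hsi : Integrable (fun ω => M * (∑ i, c (fun j => U j ω) i * ξ i ω) ^ 2) P :=
    hL.integrable_sq.const_mul M
  have hDi : Integrable (fun ω => ∑ i, c (fun j => U j ω) i * (ε i ω ^ 2 - g i (U i ω))) P :=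
    memLp_one_iff_integrable.1 (h.memLp_sum hc hcb fun i => memLp_one_iff_integrable.2
      ((h.integrable_sq i).sub (h.integrable_var i)))
  -- The sign of `b` needs an index: for `n = 0` the hypothesis `hcb` says nothing about `b`.
  have hbn : ∀ i : Fin n, 0 ≤ b := fun i => by
    obtain ⟨ω⟩ := nonempty_of_isProbabilityMeasure P
    exact (abs_nonneg _).trans (hcb (fun j => U j ω) i)
  calc _ ≤ ∫ ω, ((1 / M + M * (∑ i, c (fun j => U j ω) i * ξ i ω) ^ 2)
        + ∑ i, b * |ρ i ω|) ∂P :=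
        integral_mono hDi.abs (((integrable_const _).add hsi).add hci) hpt
    _ = 1 / M + M * ∫ ω, (∑ i, c (fun j => U j ω) i * ξ i ω) ^ 2 ∂P
        + ∑ i, b * ∫ ω, |ρ i ω| ∂P := by
        have i0 : Integrable (fun _ : Ω => 1 / M) P := integrable_const _
        have e1 := integral_add (i0.add hsi) hci
        simp only [Pi.add_apply] at e1
        rw [e1, integral_add i0 hsi, integral_finsetSum _ fun i _ => (hρi i).abs.const_mul b, integral_const_mul]
        simp only [integral_const_mul]
        simp
    _ ≤ 1 / M + M * (n * (b ^ 2 * M ^ 4)) + ∑ _i : Fin n, b * (2 * κ₃ / M) := by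
        refine add_le_add (add_le_add le_rfl (mul_le_mul_of_nonneg_left hmain hM.le)) ?_
        exact Finset.sum_le_sum fun i _ => mul_le_mul_of_nonneg_left (hρb i) (hbn i)
    _ = _ := by simp; ring

/-- `L¹` distance between the residual-based and the conditional variance. -/
lemma integral_abs_robust_sub_le (h : ErrorModel P U ε g σlo σhi κ₃) {n : ℕ}
    {w : (Fin n → α) → Fin n → ℝ} (hw : Measurable w) {b : ℝ} (hb : 0 < b)
    (hwb : ∀ u i, |w u i| ≤ b) (hw1 : ∀ u, ∑ i, w u i ^ 2 = 1) {M : ℝ} (hM : 0 < M) :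
    Integrable (fun ω => ∑ i, w (fun j => U j ω) i ^ 2 * (ε i ω
        - (∑ j, w (fun j => U j ω) j * ε j ω) * w (fun j => U j ω) i) ^ 2
        - ∑ i, w (fun j => U j ω) i ^ 2 * g i (U i ω)) P ∧
    ∫ ω, |∑ i, w (fun j => U j ω) i ^ 2 * (ε i ω
        - (∑ j, w (fun j => U j ω) j * ε j ω) * w (fun j => U j ω) i) ^ 2
        - ∑ i, w (fun j => U j ω) i ^ 2 * g i (U i ω)| ∂P
      ≤ 1 / M + n * b ^ 4 * M ^ 5 + n * b ^ 2 * (2 * κ₃ / M)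
        + n * b ^ 2 * σhi ^ 2 * (b + b ^ 2 + b ^ 3) := by
  set W : Ω → Fin n → ℝ := fun ω => w (fun j => U j ω) with hW
  set Z : Ω → ℝ := fun ω => ∑ j, W ω j * ε j ω with hZ
  set Y : Ω → ℝ := fun ω => ∑ j, W ω j ^ 3 * ε j ω with hY
  set D : Ω → ℝ := fun ω => ∑ i, W ω i ^ 2 * (ε i ω ^ 2 - g i (U i ω)) with hD
  have hpow : ∀ k : ℕ, Measurable fun u i => w u i ^ k := fun k =>
    measurable_pi_lambda _ fun i => ((measurable_pi_apply i).comp hw).pow_const k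
  have hpowb : ∀ (k : ℕ) u i, |w u i ^ k| ≤ b ^ k := fun k u i => by
    rw [abs_pow]; exact pow_le_pow_left₀ (abs_nonneg _) (hwb u i) k
  have hεL : ∀ i : Fin n, MemLp (ε i) 2 P := fun i => h.memLp_two i
  have hZL : MemLp Z 2 P := h.memLp_sum hw hwb hεL
  have hYL : MemLp Y 2 P := h.memLp_sum (hpow 3) (hpowb 3) hεL
  have hεm : ∀ i : Fin n,
      Measurable[MeasurableSpace.comap (fun ω => (U i ω, ε i ω)) inferInstance] (ε i) := fun i =>
    measurable_snd.comp (comap_measurable fun ω => (U i ω, ε i ω))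
  have hZ2 := h.integral_sq_sum_le hw hwb hεL hεm (fun i => h.mean_zero i)
    (fun i => h.integral_sq_le i)
  have hY2 := h.integral_sq_sum_le (hpow 3) (hpowb 3) hεL hεm (fun i => h.mean_zero i)
    (fun i => h.integral_sq_le i)
  have hDi : Integrable D P :=
    memLp_one_iff_integrable.1 (h.memLp_sum (hpow 2) (hpowb 2) fun i => memLp_one_iff_integrable.2
      ((h.integrable_sq i).sub (h.integrable_var i)))
  have hD1 := h.integral_abs_sum_sq_sub_var_le (hpow 2) (hpowb 2) hM
  -- Expanding the squared residual leaves `D`, a cross term with `Y`, which is a weighted sum of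
  -- errors with weights bounded by `b ^ 3`, and a term controlled by `∑ (W i)⁴ ≤ b²`.
  have hexp : ∀ ω, ∑ i, W ω i ^ 2 * (ε i ω - Z ω * W ω i) ^ 2 - ∑ i, W ω i ^ 2 * g i (U i ω)
      = D ω - 2 * (Z ω * Y ω) + Z ω ^ 2 * ∑ i, W ω i ^ 4 := by
    intro ω
    simp only [hD, hY]
    rw [← Finset.sum_sub_distrib, Finset.mul_sum, Finset.mul_sum, Finset.mul_sum,
      ← Finset.sum_sub_distrib, ← Finset.sum_add_distrib]
    refine Finset.sum_congr rfl fun i _ => ?_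
    ring
  have hW4 : ∀ ω, ∑ i, W ω i ^ 4 ≤ b ^ 2 := by
    intro ω
    calc ∑ i, W ω i ^ 4 ≤ ∑ i, b ^ 2 * W ω i ^ 2 := by
          refine Finset.sum_le_sum fun i _ => ?_
          have : W ω i ^ 2 ≤ b ^ 2 := by
            rw [← sq_abs]; exact pow_le_pow_left₀ (abs_nonneg _) (hwb _ i) 2
          nlinarith [sq_nonneg (W ω i)]
      _ = b ^ 2 := by rw [← Finset.mul_sum, hw1, mul_one]
  have hW40 : ∀ ω, 0 ≤ ∑ i, W ω i ^ 4 := fun ω => Finset.sum_nonneg fun i _ => by positivity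
  have hW4m : Measurable fun ω => ∑ i, W ω i ^ 4 :=
    Finset.measurable_fun_sum _ fun i _ => (h.measurable_coef hw i).pow_const 4
  have hZ4 : Integrable (fun ω => Z ω ^ 2 * ∑ i, W ω i ^ 4) P :=
    hZL.integrable_sq.mul_bdd (c := b ^ 2) hW4m.aestronglyMeasurable (ae_of_all _ fun ω => by
      rw [Real.norm_eq_abs, abs_of_nonneg (hW40 ω)]; exact hW4 ω)
  have hZY : Integrable (fun ω => 2 * (Z ω * Y ω)) P := (hZL.integrable_mul hYL).const_mul 2
  have hi : Integrable (fun ω => ∑ i, W ω i ^ 2 * (ε i ω - Z ω * W ω i) ^ 2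
      - ∑ i, W ω i ^ 2 * g i (U i ω)) P := by
    simp only [hexp]
    exact (hDi.sub hZY).add hZ4
  refine ⟨hi, ?_⟩
  have hpt : ∀ ω, |∑ i, W ω i ^ 2 * (ε i ω - Z ω * W ω i) ^ 2 - ∑ i, W ω i ^ 2 * g i (U i ω)|
      ≤ |D ω| + ((b + b ^ 2) * Z ω ^ 2 + b⁻¹ * Y ω ^ 2) := by
    intro ω
    rw [hexp]
    -- The weight `b` gives second moment bounds `n b³ σhi²` for the `Z` part and `n b⁵ σhi²` for
    -- the `Y` part, both vanishing when `b` is of order `1 / √n`.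
    have h1 : |2 * (Z ω * Y ω)| ≤ b * Z ω ^ 2 + b⁻¹ * Y ω ^ 2 := by
      have e1 : b * Z ω ^ 2 + b⁻¹ * Y ω ^ 2 - 2 * (Z ω * Y ω) = b⁻¹ * (b * Z ω - Y ω) ^ 2 := by
        field_simp; ring
      have e2 : b * Z ω ^ 2 + b⁻¹ * Y ω ^ 2 + 2 * (Z ω * Y ω) = b⁻¹ * (b * Z ω + Y ω) ^ 2 := by
        field_simp; ring
      have p1 : 0 ≤ b⁻¹ * (b * Z ω - Y ω) ^ 2 := by positivity
      have p2 : 0 ≤ b⁻¹ * (b * Z ω + Y ω) ^ 2 := by positivity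
      rw [abs_le]; constructor <;> linarith
    have h2 : |Z ω ^ 2 * ∑ i, W ω i ^ 4| ≤ b ^ 2 * Z ω ^ 2 := by
      rw [abs_of_nonneg (mul_nonneg (sq_nonneg _) (hW40 ω)), mul_comm]
      exact mul_le_mul_of_nonneg_right (hW4 ω) (sq_nonneg _)
    calc _ ≤ |D ω| + |2 * (Z ω * Y ω)| + |Z ω ^ 2 * ∑ i, W ω i ^ 4| :=
          (abs_add_le _ _).trans (add_le_add (abs_sub _ _) le_rfl)
      _ ≤ _ := by linarith
  have iZ : Integrable (fun ω => (b + b ^ 2) * Z ω ^ 2) P := hZL.integrable_sq.const_mul _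
  have iY : Integrable (fun ω => b⁻¹ * Y ω ^ 2) P := hYL.integrable_sq.const_mul _
  calc _ ≤ ∫ ω, (|D ω| + ((b + b ^ 2) * Z ω ^ 2 + b⁻¹ * Y ω ^ 2)) ∂P :=
        integral_mono hi.abs (hDi.abs.add (iZ.add iY)) hpt
    _ = ∫ ω, |D ω| ∂P + ((b + b ^ 2) * ∫ ω, Z ω ^ 2 ∂P + b⁻¹ * ∫ ω, Y ω ^ 2 ∂P) := by
        have e1 := integral_add hDi.abs (iZ.add iY)
        simp only [Pi.add_apply] at e1
        rw [e1, integral_add iZ iY, integral_const_mul,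
          integral_const_mul]
    _ ≤ (1 / M + n * (b ^ 2) ^ 2 * M ^ 5 + n * b ^ 2 * (2 * κ₃ / M))
        + ((b + b ^ 2) * (n * (b ^ 2 * σhi ^ 2))
          + b⁻¹ * (n * ((b ^ 3) ^ 2 * σhi ^ 2))) := by
        refine add_le_add hD1 (add_le_add ?_ ?_)
        · exact mul_le_mul_of_nonneg_left hZ2 (by positivity)
        · exact mul_le_mul_of_nonneg_left hY2 (by positivity)
    _ = _ := by field_simp

end ErrorModel

/-! ### Convergence in probability and in distribution -/

section Convergence

variable {Ω : Type*} [mΩ : MeasurableSpace Ω] {P : Measure Ω} [IsProbabilityMeasure P]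

lemma tendstoInMeasure_zero_of_integral_abs_le {X : ℕ → Ω → ℝ} {r : ℕ → ℝ}
    (hX : ∀ᶠ n in atTop, Integrable (X n) P ∧ ∫ ω, |X n ω| ∂P ≤ r n)
    (hr : Tendsto r atTop (𝓝 0)) : TendstoInMeasure P X atTop 0 := by
  rw [tendstoInMeasure_iff_measureReal_norm]
  intro δ hδ
  have hr' : Tendsto (fun n => r n / δ) atTop (𝓝 0) := by simpa using hr.div_const δ
  refine tendsto_of_tendsto_of_tendsto_of_le_of_le' tendsto_const_nhds hr'
    (Eventually.of_forall fun n => measureReal_nonneg) ?_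
  filter_upwards [hX] with n ⟨hi, hle⟩
  rw [le_div_iff₀ hδ]
  have := mul_meas_ge_le_integral_of_nonneg (ae_of_all P fun ω => abs_nonneg (X n ω)) hi.abs δ
  simp only [Pi.zero_apply, sub_zero, Real.norm_eq_abs]
  linarith

/-- Asymptotic normality is unaffected by changes on events of vanishing probability. -/
lemma AsympStdNormal.of_measure_ne {X Y : ℕ → Ω → ℝ} (hX : AsympStdNormal P X)
    (hY : ∀ n, AEMeasurable (Y n) P)
    (h : Tendsto (fun n => P.real {ω | X n ω ≠ Y n ω}) atTop (𝓝 0)) : AsympStdNormal P Y := by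
  refine tendstoInDistribution_of_tendstoInMeasure_sub Y id hX ?_ hY
  rw [tendstoInMeasure_iff_measureReal_norm]
  intro δ hδ
  refine tendsto_of_tendsto_of_tendsto_of_le_of_le tendsto_const_nhds h
    (fun n => measureReal_nonneg) fun n => measureReal_mono fun ω hω => ?_
  intro e
  simp only [Set.mem_ofPred_eq, Pi.sub_apply, Pi.zero_apply, e, sub_self, norm_zero] at hω
  linarith

/-- Lévy's criterion for asymptotic standard normality. -/
lemma asympStdNormal_of_charFun {X : ℕ → Ω → ℝ} (hX : ∀ n, Measurable (X n))
    (h : ∀ t : ℝ, Tendsto (fun n => ∫ ω, Complex.exp ((t * X n ω : ℝ) * Complex.I) ∂P) atTop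
      (𝓝 ((Real.exp (-(t ^ 2 / 2)) : ℝ) : ℂ))) : AsympStdNormal P X where
  forall_aemeasurable n := (hX n).aemeasurable
  tendsto := by
    refine ProbabilityMeasure.tendsto_iff_tendsto_charFun.2 fun t => ?_
    have h1 : charFun ((gaussianReal 0 1).map (id : ℝ → ℝ)) t
        = ((Real.exp (-(t ^ 2 / 2)) : ℝ) : ℂ) := by
      rw [Measure.map_id, charFun_gaussianReal]
      push_cast
      congr 1
      simp
    have h2 : ∀ n, charFun (P.map (X n)) t
        = ∫ ω, Complex.exp ((t * X n ω : ℝ) * Complex.I) ∂P := by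
      intro n
      rw [charFun_apply_real, integral_map (hX n).aemeasurable (by fun_prop)]
      push_cast; rfl
    simp only [ProbabilityMeasure.coe_mk]
    rw [h1]
    simp only [h2]
    exact h t

/-- Slutsky's theorem for products with a factor converging to `1` in probability. -/
lemma AsympStdNormal.mul {X R : ℕ → Ω → ℝ} (hX : AsympStdNormal P X)
    (hR : TendstoInMeasure P R atTop fun _ => (1 : ℝ)) (hRm : ∀ n, AEMeasurable (R n) P) :
    AsympStdNormal P (fun n ω => X n ω * R n ω) := by
  have := hX.continuous_comp_prodMk_of_tendstoInMeasure_const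
    (g := fun z : ℝ × ℝ => z.1 * z.2) (by fun_prop) hR hRm
  simpa using! this

/-- The lower bound on `v` turns the absolute error `V - v` into a relative one, and `y ↦ 1 / √y` is
continuous at 1. -/
lemma tendstoInMeasure_sqrt_div_sqrt {V v : ℕ → Ω → ℝ} {s : ℝ} (hs : 0 < s)
    (hv : ∀ᶠ n in atTop, ∀ ω, s ≤ v n ω)
    (h : TendstoInMeasure P (fun n ω => V n ω - v n ω) atTop 0) :
    TendstoInMeasure P (fun n ω => √(v n ω) / √(V n ω)) atTop fun _ => (1 : ℝ) := by
  rw [tendstoInMeasure_iff_measureReal_norm] at h ⊢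
  intro δ hδ
  have hcont : ContinuousAt (fun y : ℝ => 1 / √y) 1 :=
    continuousAt_const.div Real.continuous_sqrt.continuousAt (by simp)
  obtain ⟨η, hη, hclose⟩ := Metric.continuousAt_iff.1 hcont δ hδ
  refine tendsto_of_tendsto_of_tendsto_of_le_of_le' tendsto_const_nhds (h (η * s) (by positivity))
    (Eventually.of_forall fun n => measureReal_nonneg) ?_
  filter_upwards [hv] with n hn
  refine measureReal_mono fun ω hω => ?_
  simp only [Set.mem_ofPred_eq, Pi.zero_apply, sub_zero, Real.norm_eq_abs] at hω ⊢
  by_contra! hlt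
  have hv0 : 0 < v n ω := hs.trans_le (hn ω)
  have h1 : dist (V n ω / v n ω) 1 < η := by
    rw [Real.dist_eq, div_sub_one hv0.ne', abs_div, abs_of_pos hv0, div_lt_iff₀ hv0]
    exact hlt.trans_le (mul_le_mul_of_nonneg_left (hn ω) hη.le)
  have h2 := hclose h1
  rw [Real.dist_eq, Real.sqrt_div' _ hv0.le] at h2
  simp only [Real.sqrt_one, one_div_div] at h2
  norm_num at h2
  linarith

end Convergence

/-! ### Delocalization and the normalised t-statistic -/

/-- The regressor is nonzero and spread out: no entry exceeds `K / √n` times the Euclidean norm. -/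
def IsDelocalized (K : ℝ) {n : ℕ} (c : Fin n → ℝ) : Prop :=
  0 < c ⬝ᵥ c ∧ ∀ i, |c i| ≤ K / √n * √(c ⬝ᵥ c)

lemma measurableSet_isDelocalized (K : ℝ) (n : ℕ) :
    MeasurableSet {c : Fin n → ℝ | IsDelocalized K c} := by
  have h1 : Measurable fun c : Fin n → ℝ => c ⬝ᵥ c := by
    unfold dotProduct; fun_prop
  simp only [IsDelocalized, Set.ofPred_and, Set.ofPred_forall]
  refine (measurableSet_lt measurable_const h1).inter (MeasurableSet.iInter fun i => ?_)
  exact measurableSet_le (by fun_prop) (by fun_prop)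

/-- The t-statistic in terms of the normalised regressor `w = C / ‖C‖`. -/
lemma tStatistic_eq {n : ℕ} (β : ℝ) (c e : Fin n → ℝ) (hc : 0 < c ⬝ᵥ c) :
    tStatistic (outcome β c e) c β =
      (∑ j, c j / √(c ⬝ᵥ c) * e j) /
        √(∑ i, (c i / √(c ⬝ᵥ c)) ^ 2 *
          (e i - (∑ j, c j / √(c ⬝ᵥ c) * e j) * (c i / √(c ⬝ᵥ c))) ^ 2) := by
  set q := c ⬝ᵥ c with hq
  set r := √q with hr
  have hr0 : 0 < r := Real.sqrt_pos.2 hc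
  have hrq : r ^ 2 = q := Real.sq_sqrt hc.le
  set Z := ∑ j, c j / r * e j with hZ
  have hols : olsEstimator (outcome β c e) c = β + Z / r := by
    have h1 : outcome β c e ⬝ᵥ c = β * q + r * Z := by
      simp only [outcome, dotProduct, hq, hZ, Finset.mul_sum]
      rw [← Finset.sum_add_distrib]
      refine Finset.sum_congr rfl fun i _ => ?_
      field_simp
    rw [olsEstimator, h1, ← hq, ← hrq]
    field_simp
  have hV : robustVariance (outcome β c e) c
      = (∑ i, (c i / r) ^ 2 * (e i - Z * (c i / r)) ^ 2) / q := by
    have h2 : ∑ i, c i ^ 2 = q := by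
      simp only [hq, dotProduct, sq]
    rw [robustVariance, h2, eq_div_iff hc.ne', Finset.mul_sum, Finset.sum_mul]
    refine Finset.sum_congr rfl fun i _ => ?_
    have h3 : residual (outcome β c e) c i = e i - Z * (c i / r) := by
      rw [residual, hols, outcome]; ring
    rw [h3, div_pow, hrq]
    field_simp
  rw [tStatistic, hV, hols, Real.sqrt_div' _ hc.le, ← hr, add_sub_cancel_left]
  rw [div_div_div_cancel_right₀ hr0.ne']

lemma measurable_tStatistic {Ω : Type*} [MeasurableSpace Ω] {n : ℕ} (β : ℝ)
    {c e : Ω → Fin n → ℝ} (hc : ∀ i, Measurable fun ω => c ω i)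
    (he : ∀ i, Measurable fun ω => e ω i) :
    Measurable fun ω => tStatistic (outcome β (c ω) (e ω)) (c ω) β := by
  unfold tStatistic robustVariance residual olsEstimator outcome dotProduct
  fun_prop

/-! ### Limit theorem for delocalized regressors -/

namespace ErrorModel

variable {Ω α : Type*} [mΩ : MeasurableSpace Ω] [MeasurableSpace α] {P : Measure Ω}
  {U : ℕ → Ω → α} {ε : ℕ → Ω → ℝ} {g : ℕ → α → ℝ} {σlo σhi κ₃ : ℝ}

section Weights

variable {w : (n : ℕ) → (Fin n → α) → Fin n → ℝ} {K : ℝ}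

lemma le_sum_sq_mul_var (h : ErrorModel P U ε g σlo σhi κ₃) {n : ℕ} {v : Fin n → ℝ}
    (hv : ∑ i, v i ^ 2 = 1) (u : Fin n → α) : σlo ^ 2 ≤ ∑ i, v i ^ 2 * g i (u i) := by
  calc σlo ^ 2 = ∑ i, v i ^ 2 * σlo ^ 2 := by rw [← Finset.sum_mul, hv, one_mul]
    _ ≤ _ := Finset.sum_le_sum fun i _ => mul_le_mul_of_nonneg_left (h.le_var i _) (sq_nonneg _)

variable [IsProbabilityMeasure P]

/-- Central limit theorem for weighted errors standardised by their conditional variance. -/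
lemma asympStdNormal_sum_div_sqrt_var (h : ErrorModel P U ε g σlo σhi κ₃)
    (hw : ∀ n, Measurable (w n))
    (hwb : ∀ n, 1 ≤ n → ∀ u i, |w n u i| ≤ K / √n) (hw1 : ∀ n, 1 ≤ n → ∀ u, ∑ i, w n u i ^ 2 = 1) :
    AsympStdNormal P (fun n ω => (∑ i, w n (fun j => U j ω) i * ε i ω) /
      √(∑ i, w n (fun j => U j ω) i ^ 2 * g i (U i ω))) := by
  have hvm : ∀ n, Measurable fun u : Fin n → α => ∑ i, w n u i ^ 2 * g i (u i) := fun n =>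
    Finset.measurable_fun_sum _ fun i _ => (((measurable_pi_apply i).comp (hw n)).pow_const 2).mul
      ((h.measurable_var i).comp (measurable_pi_apply i))
  set x : (n : ℕ) → (Fin n → α) → Fin n → ℝ := fun n u i =>
    w n u i / √(∑ j, w n u j ^ 2 * g j (u j)) with hx
  have hxm : ∀ n, Measurable (x n) := fun n => measurable_pi_lambda _ fun i =>
    ((measurable_pi_apply i).comp (hw n)).div (Real.continuous_sqrt.measurable.comp (hvm n))
  have hsum : ∀ n ω, (∑ i, w n (fun j => U j ω) i * ε i ω) /
      √(∑ i, w n (fun j => U j ω) i ^ 2 * g i (U i ω))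
      = ∑ i, x n (fun j => U j ω) i * ε i ω := by
    intro n ω
    rw [Finset.sum_div]
    refine Finset.sum_congr rfl fun i _ => ?_
    simp only [hx]; ring
  simp only [hsum]
  refine asympStdNormal_of_charFun (fun n => ?_) fun t => ?_
  · exact Finset.measurable_fun_sum _ fun i _ =>
      (h.measurable_coef (hxm n) i).mul (h.measurable_error i)
  rw [tendsto_iff_norm_sub_tendsto_zero]
  set a := |t| * (K / σlo) with ha
  -- The two terms are `n * 4(|t|b)³κ₃` and `n * (|t|b)⁴σhi⁴` at `b = K / (σlo √n)`.
  have hlim : Tendsto (fun n : ℕ => 4 * a ^ 3 * κ₃ * (√(n : ℝ))⁻¹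
      + a ^ 4 * σhi ^ 4 * ((√(n : ℝ))⁻¹ * (√(n : ℝ))⁻¹)) atTop (𝓝 0) := by
    have h0 : Tendsto (fun n : ℕ => (√(n : ℝ))⁻¹) atTop (𝓝 0) :=
      tendsto_inv_atTop_zero.comp (Real.tendsto_sqrt_atTop.comp tendsto_natCast_atTop_atTop)
    simpa using (h0.const_mul (4 * a ^ 3 * κ₃)).add ((h0.mul h0).const_mul (a ^ 4 * σhi ^ 4))
  refine tendsto_of_tendsto_of_tendsto_of_le_of_le' tendsto_const_nhds hlim
    (Eventually.of_forall fun n => norm_nonneg _) ?_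
  filter_upwards [eventually_ge_atTop 1] with n hn
  have hn0 : (0 : ℝ) < n := by exact_mod_cast hn
  have hs0 : 0 < √(n : ℝ) := Real.sqrt_pos.2 hn0
  have hσ := h.σlo_pos
  have hx1 : ∀ u, ∑ i, x n u i ^ 2 * g i (u i) = 1 := by
    intro u
    have h1 := h.le_sum_sq_mul_var (hw1 n hn u) u
    set v := ∑ i, w n u i ^ 2 * g i (u i) with hv
    have hv0 : 0 < v := lt_of_lt_of_le (by positivity) h1
    calc ∑ i, x n u i ^ 2 * g i (u i) = ∑ i, w n u i ^ 2 * g i (u i) / v := by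
          refine Finset.sum_congr rfl fun i _ => ?_
          simp only [hx]
          rw [← hv, div_pow, Real.sq_sqrt hv0.le]; ring
      _ = 1 := by rw [← Finset.sum_div, ← hv, div_self hv0.ne']
  have hxb : ∀ u i, |x n u i| ≤ K / √n / σlo := by
    intro u i
    have h1 := h.le_sum_sq_mul_var (hw1 n hn u) u
    have h2 : σlo ≤ √(∑ j, w n u j ^ 2 * g j (u j)) := Real.le_sqrt_of_sq_le h1
    simp only [hx]
    rw [abs_div, abs_of_pos (hσ.trans_le h2)]
    exact div_le_div₀ ((abs_nonneg _).trans (hwb n hn u i)) (hwb n hn u i) hσ h2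
  refine (h.norm_integral_exp_sub_le (hxm n) hxb hx1 t).trans (le_of_eq ?_)
  have e1 : |t| * (K / √n / σlo) = a * (√(n : ℝ))⁻¹ := by rw [ha]; ring
  rw [e1]
  have e2 : (n : ℝ) = √(n : ℝ) ^ 2 := (Real.sq_sqrt hn0.le).symm
  nth_rewrite 1 [e2]
  field_simp

/-- Consistency of the robust variance estimator for the conditional variance. -/
lemma tendstoInMeasure_robust_sub (h : ErrorModel P U ε g σlo σhi κ₃) (hK : 0 < K)
    (hw : ∀ n, Measurable (w n))
    (hwb : ∀ n, 1 ≤ n → ∀ u i, |w n u i| ≤ K / √n) (hw1 : ∀ n, 1 ≤ n → ∀ u, ∑ i, w n u i ^ 2 = 1) :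
    TendstoInMeasure P (fun n ω => ∑ i, w n (fun j => U j ω) i ^ 2 * (ε i ω
        - (∑ j, w n (fun j => U j ω) j * ε j ω) * w n (fun j => U j ω) i) ^ 2
        - ∑ i, w n (fun j => U j ω) i ^ 2 * g i (U i ω)) atTop 0 := by
  set s : ℕ → ℝ := fun n => √(n : ℝ) with hs
  -- The truncation level satisfies `M ^ 5 = √n`: it tends to infinity, yet `n b⁴ M⁵ = K⁴ / √n`
  -- still vanishes.
  set M : ℕ → ℝ := fun n => s n ^ (1 / 5 : ℝ) with hM
  set b : ℕ → ℝ := fun n => K / s n with hb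
  have hs1 : Tendsto s atTop atTop := Real.tendsto_sqrt_atTop.comp tendsto_natCast_atTop_atTop
  have hs0 : Tendsto (fun n => (s n)⁻¹) atTop (𝓝 0) := tendsto_inv_atTop_zero.comp hs1
  have hM0 : Tendsto (fun n => (M n)⁻¹) atTop (𝓝 0) :=
    tendsto_inv_atTop_zero.comp ((tendsto_rpow_atTop (by norm_num)).comp hs1)
  have hb0 : Tendsto b atTop (𝓝 0) := by
    simpa [hb, div_eq_mul_inv] using hs0.const_mul K
  refine tendstoInMeasure_zero_of_integral_abs_le (r := fun n => (M n)⁻¹ + K ^ 4 * (s n)⁻¹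
    + K ^ 2 * (2 * κ₃ * (M n)⁻¹) + K ^ 2 * σhi ^ 2 * (b n + b n ^ 2 + b n ^ 3)) ?_ ?_
  · filter_upwards [eventually_ge_atTop 1] with n hn
    have hn0 : (0 : ℝ) < n := by exact_mod_cast hn
    have hsn : 0 < s n := Real.sqrt_pos.2 hn0
    have hMn : 0 < M n := Real.rpow_pos_of_pos hsn _
    have hbn : 0 < b n := div_pos hK hsn
    have hM5 : M n ^ 5 = s n := by
      rw [hM]
      simp only
      rw [← Real.rpow_natCast, ← Real.rpow_mul hsn.le]
      norm_num
    obtain ⟨h1, h2⟩ := h.integral_abs_robust_sub_le (hw n) hbn (hwb n hn) (hw1 n hn) hMn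
    refine ⟨h1, h2.trans (le_of_eq ?_)⟩
    have e2 : (n : ℝ) = s n ^ 2 := (Real.sq_sqrt hn0.le).symm
    have e3 : (n : ℝ) * b n ^ 2 = K ^ 2 := by
      rw [e2, hb]; field_simp
    have e4 : (n : ℝ) * b n ^ 4 * M n ^ 5 = K ^ 4 * (s n)⁻¹ := by
      rw [hM5, e2, hb]; field_simp
    rw [e3, e4]
    ring
  · have hbb : Tendsto (fun n => b n + b n ^ 2 + b n ^ 3) atTop (𝓝 0) := by
      simpa using (hb0.add (hb0.pow 2)).add (hb0.pow 3)
    simpa using ((hM0.add (hs0.const_mul (K ^ 4))).add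
      ((hM0.const_mul (2 * κ₃)).const_mul (K ^ 2))).add (hbb.const_mul (K ^ 2 * σhi ^ 2))

/-- Self-normalised central limit theorem with type-dependent weights. -/
lemma asympStdNormal_selfNormalized (h : ErrorModel P U ε g σlo σhi κ₃) (hK : 0 < K)
    (hw : ∀ n, Measurable (w n))
    (hwb : ∀ n, 1 ≤ n → ∀ u i, |w n u i| ≤ K / √n) (hw1 : ∀ n, 1 ≤ n → ∀ u, ∑ i, w n u i ^ 2 = 1) :
    AsympStdNormal P (fun n ω => (∑ j, w n (fun j => U j ω) j * ε j ω) /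
      √(∑ i, w n (fun j => U j ω) i ^ 2 * (ε i ω
        - (∑ j, w n (fun j => U j ω) j * ε j ω) * w n (fun j => U j ω) i) ^ 2)) := by
  have hσ := h.σlo_pos
  have hlow : ∀ᶠ n in atTop, ∀ ω, σlo ^ 2 ≤ ∑ i, w n (fun j => U j ω) i ^ 2 * g i (U i ω) := by
    filter_upwards [eventually_ge_atTop 1] with n hn ω
    exact h.le_sum_sq_mul_var (hw1 n hn _) fun j : Fin n => U j ω
  have hR := tendstoInMeasure_sqrt_div_sqrt (by positivity : 0 < σlo ^ 2) hlow
    (h.tendstoInMeasure_robust_sub hK hw hwb hw1)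
  have hcm := fun n i => h.measurable_coef (hw n) i
  have hε := h.measurable_error
  have hgm : ∀ i, Measurable fun ω => g i (U i ω) := fun i =>
    (h.measurable_var i).comp (h.measurable_type i)
  have hZm : ∀ n, Measurable fun ω => ∑ j, w n (fun j => U j ω) j * ε j ω := fun n =>
    Finset.measurable_fun_sum _ fun i _ => (hcm n i).mul (hε i)
  have hVm : ∀ n, Measurable fun ω => √(∑ i, w n (fun j => U j ω) i ^ 2 * (ε i ω
      - (∑ j, w n (fun j => U j ω) j * ε j ω) * w n (fun j => U j ω) i) ^ 2) := fun n =>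
    (Finset.measurable_fun_sum _ fun i _ => ((hcm n i).pow_const 2).mul
      (((hε i).sub ((hZm n).mul (hcm n i))).pow_const 2)).sqrt
  have hvm : ∀ n, Measurable fun ω => √(∑ i, w n (fun j => U j ω) i ^ 2 * g i (U i ω)) := fun n =>
    (Finset.measurable_fun_sum _ fun i _ => ((hcm n i).pow_const 2).mul (hgm i)).sqrt
  have hprod := (h.asympStdNormal_sum_div_sqrt_var hw hwb hw1).mul hR
    (fun n => ((hvm n).div (hVm n)).aemeasurable)
  -- The factor `√v` cancels wherever it is nonzero, which is everywhere once `n ≥ 1`.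
  refine hprod.of_measure_ne (fun n => ((hZm n).div (hVm n)).aemeasurable) ?_
  refine tendsto_const_nhds.congr' ?_
  filter_upwards [hlow] with n hn
  symm
  rw [measureReal_eq_zero_iff]
  convert measure_empty (μ := P)
  ext ω
  simp only [Set.mem_ofPred_eq, Set.mem_empty_iff_false, iff_false, not_not]
  have h0 : √(∑ i, w n (fun j => U j ω) i ^ 2 * g i (U i ω)) ≠ 0 :=
    (Real.sqrt_pos.2 (lt_of_lt_of_le (by positivity) (hn ω))).ne'
  rw [div_mul_div_comm, mul_comm, mul_div_mul_left _ _ h0]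

end Weights

variable [IsProbabilityMeasure P]

/-- The t-statistic is asymptotically standard normal whenever the regressor, a function of the
types, is delocalized with probability tending to one. -/
theorem asympStdNormal_tStatistic (h : ErrorModel P U ε g σlo σhi κ₃)
    {c : (n : ℕ) → (Fin n → α) → Fin n → ℝ} (hc : ∀ n, Measurable (c n)) {K : ℝ}
    (hdel : Tendsto (fun n => P.real {ω | ¬ IsDelocalized K (c n fun j => U j ω)}) atTop (𝓝 0))
    (β : ℝ) : AsympStdNormal P (fun n ω => tStatistic
      (outcome β (c n fun j => U j ω) fun i => ε i ω) (c n fun j => U j ω) β) := by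
  classical
  -- Off the good event the direction is replaced by the flat unit vector, so that the weight bounds
  -- hold surely, with constant `max K 1`. The statistic changes only with vanishing probability.
  set w : (n : ℕ) → (Fin n → α) → Fin n → ℝ := fun n u =>
    if IsDelocalized K (c n u) then fun i => c n u i / √(c n u ⬝ᵥ c n u) else fun _ => 1 / √n
    with hwdef
  have hw : ∀ n, Measurable (w n) := by
    intro n
    refine Measurable.ite (hc n (measurableSet_isDelocalized K n)) ?_ measurable_const
    have hi : ∀ i, Measurable fun u => c n u i := fun i => (measurable_pi_apply i).comp (hc n)
    refine measurable_pi_lambda _ fun i => ?_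
    unfold dotProduct
    fun_prop
  have hwb : ∀ n, 1 ≤ n → ∀ u i, |w n u i| ≤ max K 1 / √n := by
    intro n hn u i
    have hs0 : 0 < √(n : ℝ) := Real.sqrt_pos.2 (by exact_mod_cast hn)
    simp only [hwdef]
    split_ifs with hd
    · have hr0 := Real.sqrt_pos.2 hd.1
      rw [abs_div, abs_of_pos hr0, div_le_iff₀ hr0]
      refine (hd.2 i).trans (mul_le_mul_of_nonneg_right ?_ hr0.le)
      exact div_le_div_of_nonneg_right (le_max_left _ _) hs0.le
    · rw [abs_of_pos (by positivity)]
      exact div_le_div_of_nonneg_right (le_max_right _ _) hs0.le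
  have hw1 : ∀ n, 1 ≤ n → ∀ u, ∑ i, w n u i ^ 2 = 1 := by
    intro n hn u
    have hn0 : (0 : ℝ) < n := by exact_mod_cast hn
    simp only [hwdef]
    split_ifs with hd
    · simp only [div_pow, Real.sq_sqrt hd.1.le]
      rw [← Finset.sum_div, div_eq_one_iff_eq hd.1.ne']
      simp only [dotProduct, sq]
    · simp only [div_pow, Real.sq_sqrt hn0.le]
      simp [hn0.ne']
  have hmain := h.asympStdNormal_selfNormalized (lt_max_of_lt_right one_pos) hw hwb hw1
  refine hmain.of_measure_ne (fun n => (measurable_tStatistic β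
    (fun i => h.measurable_coef (hc n) i) fun i => h.measurable_error i).aemeasurable) ?_
  refine tendsto_of_tendsto_of_tendsto_of_le_of_le tendsto_const_nhds hdel
    (fun n => measureReal_nonneg) fun n => measureReal_mono fun ω hω => ?_
  intro hd
  refine hω ?_
  have e : w n (fun j => U j ω)
      = fun i => c n (fun j => U j ω) i / √(c n (fun j => U j ω) ⬝ᵥ c n fun j => U j ω) := by
    simp only [hwdef]; rw [if_pos hd]
  rw [tStatistic_eq β _ _ hd.1]
  simp only [e]

end ErrorModel

/-! ### Delocalization of eigenvectors and of diffusion centralities -/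

section Matrices

variable {n : ℕ} {A : Matrix (Fin n) (Fin n) ℝ}

lemma sq_dotProduct_le (x y : Fin n → ℝ) : (x ⬝ᵥ y) ^ 2 ≤ (x ⬝ᵥ x) * (y ⬝ᵥ y) := by
  have := Finset.sum_mul_sq_le_sq_mul_sq Finset.univ x y
  simpa only [dotProduct, ← sq] using this

lemma dotProduct_self_nonneg_real (x : Fin n → ℝ) : 0 ≤ x ⬝ᵥ x :=
  Finset.sum_nonneg fun i _ => mul_self_nonneg (x i)

/-- Each row of `A` has norm at most `p √n`. One application of `A` thus flattens any vector,
provided that its norm grows enough. -/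
lemma abs_mulVec_le {p : ℝ} (hp : 0 ≤ p) (h0 : ∀ i j, 0 ≤ A i j) (hA : ∀ i j, A i j ≤ p)
    (x : Fin n → ℝ) (i : Fin n) : |(A *ᵥ x) i| ≤ p * √n * √(x ⬝ᵥ x) := by
  have h1 : ((A *ᵥ x) i) ^ 2 ≤ (p * √n * √(x ⬝ᵥ x)) ^ 2 := by
    rw [mul_pow, mul_pow, Real.sq_sqrt (Nat.cast_nonneg n), Real.sq_sqrt (dotProduct_self_nonneg_real x)]
    refine (sq_dotProduct_le (fun j => A i j) x).trans
      (mul_le_mul_of_nonneg_right ?_ (dotProduct_self_nonneg_real x))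
    calc (fun j => A i j) ⬝ᵥ (fun j => A i j) ≤ ∑ _j : Fin n, p ^ 2 :=
          Finset.sum_le_sum fun j _ => by nlinarith [h0 i j, hA i j]
      _ = p ^ 2 * n := by simp [mul_comm]
  exact abs_le_of_sq_le_sq h1 (by positivity)

/-- The quadratic form of a symmetric matrix is dominated by a bound on its eigenvalues. -/
lemma dotProduct_mulVec_le_of_eigenvalue_le (hA : A.IsSymm) {L : ℝ}
    (hL : ∀ μ : ℝ, Module.End.HasEigenvalue (Matrix.toLin' A) μ → |μ| ≤ L) (x : Fin n → ℝ) :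
    x ⬝ᵥ (A *ᵥ x) ≤ L * (x ⬝ᵥ x) := by
  have hH : A.IsHermitian := by
    rw [Matrix.IsHermitian, Matrix.conjTranspose_eq_transpose_of_trivial]; exact hA
  set b := hH.eigenvectorBasis with hb
  have hev : ∀ i, A *ᵥ (b i).ofLp = hH.eigenvalues i • (b i).ofLp := fun i =>
    hH.mulVec_eigenvectorBasis i
  have hle : ∀ i, hH.eigenvalues i ≤ L := by
    intro i
    refine (le_abs_self _).trans (hL _ ?_)
    refine Module.End.hasEigenvalue_of_hasEigenvector (x := (b i).ofLp) ⟨?_, ?_⟩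
    · rw [Module.End.mem_eigenspace_iff, Matrix.toLin'_apply]; exact hev i
    · intro h0
      have h1 : b i = 0 := by ext j; exact congrFun h0 j
      have := b.orthonormal.1 i
      rw [h1, norm_zero] at this
      exact zero_ne_one this
  have hinner : ∀ y z : Fin n → ℝ,
      ∑ i, ((b i).ofLp ⬝ᵥ y) * ((b i).ofLp ⬝ᵥ z) = y ⬝ᵥ z := by
    intro y z
    have := b.sum_inner_mul_inner (WithLp.toLp 2 y) (WithLp.toLp 2 z)
    simp only [EuclideanSpace.inner_eq_star_dotProduct, star_trivial] at this
    rw [dotProduct_comm y z, ← this]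
    refine Finset.sum_congr rfl fun i _ => ?_
    rw [dotProduct_comm z]
  have hAi : ∀ i, (b i).ofLp ⬝ᵥ (A *ᵥ x) = hH.eigenvalues i * ((b i).ofLp ⬝ᵥ x) := by
    intro i
    rw [Matrix.dotProduct_mulVec, ← Matrix.mulVec_transpose, hA.eq, hev, smul_dotProduct,
      smul_eq_mul]
  rw [← hinner x (A *ᵥ x), ← hinner x x, Finset.mul_sum]
  refine Finset.sum_le_sum fun i _ => ?_
  rw [hAi]
  nlinarith [hle i, mul_self_nonneg ((b i).ofLp ⬝ᵥ x)]

lemma one_dotProduct_one : (1 : Fin n → ℝ) ⬝ᵥ 1 = n := by simp [dotProduct]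

/-- A unit leading eigenvector of a dense nonnegative matrix is delocalized. -/
lemma IsLeadingEigenvector.isDelocalized {v : Fin n → ℝ} (hv : IsLeadingEigenvector A v)
    (hn : 1 ≤ n) (hs : A.IsSymm) {p c a : ℝ} (hp : 0 < p) (hc : 0 < c) (ha : 0 < a)
    (h0 : ∀ i j, 0 ≤ A i j) (hA : ∀ i j, A i j ≤ p) (hd : c * p * n ^ 2 ≤ 1 ⬝ᵥ (A *ᵥ 1)) :
    IsDelocalized (1 / c) (a • v) := by
  obtain ⟨hv1, lam, hlam, hmax⟩ := hv
  have hn0 : (0 : ℝ) < n := by exact_mod_cast hn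
  have hs0 : 0 < √(n : ℝ) := Real.sqrt_pos.2 hn0
  have hss : √(n : ℝ) ^ 2 = n := Real.sq_sqrt hn0.le
  -- Testing the quadratic form on `ι`, whose squared norm is `n`, yields `|λ| ≥ c p n`.
  have h1 := hd.trans (dotProduct_mulVec_le_of_eigenvalue_le hs hmax 1)
  rw [one_dotProduct_one] at h1
  have hlb : c * p * n ≤ |lam| := by
    have : c * p * n * n ≤ |lam| * n := by linarith [sq (n : ℝ)]
    exact le_of_mul_le_mul_right this hn0
  have hav : (a • v) ⬝ᵥ (a • v) = a ^ 2 := by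
    rw [smul_dotProduct, dotProduct_smul, hv1]; simp [sq]
  refine ⟨by rw [hav]; positivity, fun i => ?_⟩
  rw [hav, Real.sqrt_sq ha.le, Pi.smul_apply, smul_eq_mul, abs_mul, abs_of_pos ha, mul_comm a]
  refine mul_le_mul_of_nonneg_right ?_ ha.le
  -- For an eigenvector this reads `|λ| |v i| ≤ p √n`.
  have h2 := abs_mulVec_le hp.le h0 hA v i
  rw [hlam, hv1, Real.sqrt_one, mul_one, Pi.smul_apply, smul_eq_mul, abs_mul] at h2
  have h3 : c * p * n * |v i| ≤ p * √n :=
    (mul_le_mul_of_nonneg_right hlb (abs_nonneg _)).trans h2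
  rw [div_div, le_div_iff₀ (by positivity)]
  have h4 : p * √n * (|v i| * (c * √n)) ≤ p * √n * 1 := by
    calc p * √n * (|v i| * (c * √n)) = c * p * (√n ^ 2) * |v i| := by ring
      _ ≤ p * √n * 1 := by rw [hss, mul_one]; exact h3
  exact le_of_mul_le_mul_left h4 (by positivity)

lemma pow_succ_mulVec (t : ℕ) (x : Fin n → ℝ) : A ^ (t + 1) *ᵥ x = A *ᵥ (A ^ t *ᵥ x) := by
  rw [pow_succ', Matrix.mulVec_mulVec]

/-- The norms of the iterates `A ^ t ι` grow at least at the rate of the average degree. -/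
lemma pow_mulVec_growth (hs : A.IsSymm) {r : ℝ} (hr : 0 < r) (hn : 1 ≤ n)
    (hd : r * n ≤ 1 ⬝ᵥ (A *ᵥ 1)) (t : ℕ) :
    0 < √((A ^ t *ᵥ 1) ⬝ᵥ (A ^ t *ᵥ 1)) ∧
    r * √((A ^ t *ᵥ 1) ⬝ᵥ (A ^ t *ᵥ 1)) ≤ √((A ^ (t + 1) *ᵥ 1) ⬝ᵥ (A ^ (t + 1) *ᵥ 1)) := by
  have hn0 : (0 : ℝ) < n := by exact_mod_cast hn
  set N : ℕ → ℝ := fun t => √((A ^ t *ᵥ 1) ⬝ᵥ (A ^ t *ᵥ 1)) with hN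
  have hCS : ∀ x y : Fin n → ℝ, x ⬝ᵥ y ≤ √(x ⬝ᵥ x) * √(y ⬝ᵥ y) := by
    intro x y
    rw [← Real.sqrt_mul (dotProduct_self_nonneg_real x)]
    exact Real.le_sqrt_of_sq_le (sq_dotProduct_le x y)
  induction t with
  | zero =>
    have e0 : √((A ^ 0 *ᵥ (1 : Fin n → ℝ)) ⬝ᵥ (A ^ 0 *ᵥ 1)) = √n := by
      rw [pow_zero, Matrix.one_mulVec, one_dotProduct_one]
    have hs0 : 0 < √(n : ℝ) := Real.sqrt_pos.2 hn0
    rw [e0]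
    refine ⟨hs0, ?_⟩
    have h1 := hd.trans (hCS 1 (A *ᵥ 1))
    rw [one_dotProduct_one] at h1
    rw [zero_add, pow_one]
    have h2 : √(n : ℝ) * (r * √n) ≤ √n * √((A *ᵥ 1) ⬝ᵥ (A *ᵥ 1)) := by
      calc √(n : ℝ) * (r * √n) = r * √n ^ 2 := by ring
        _ = r * n := by rw [Real.sq_sqrt hn0.le]
        _ ≤ _ := h1
    exact le_of_mul_le_mul_left h2 hs0
  | succ t ih =>
    obtain ⟨hpos, hge⟩ := ih
    have hpos' : 0 < N (t + 1) := lt_of_lt_of_le (mul_pos hr hpos) hge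
    refine ⟨hpos', ?_⟩
    -- By symmetry `‖A^(t+1) ι‖² = ⟨A^t ι, A^(t+2) ι⟩`, so Cauchy–Schwarz makes the norms
    -- log-convex. Their successive ratios never decrease, and the bound `r` on the first ratio
    -- propagates.
    have h1 : N (t + 1) ^ 2 ≤ N t * N (t + 2) := by
      have e : (A ^ (t + 1) *ᵥ 1) ⬝ᵥ (A ^ (t + 1) *ᵥ 1)
          = (A ^ t *ᵥ 1) ⬝ᵥ (A ^ (t + 2) *ᵥ (1 : Fin n → ℝ)) := by
        rw [show t + 2 = (t + 1) + 1 from rfl, pow_succ_mulVec (t + 1), Matrix.dotProduct_mulVec _ A,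
          ← Matrix.mulVec_transpose, hs.eq, ← pow_succ_mulVec]
      have h2 : N (t + 1) ^ 2 = (A ^ t *ᵥ 1) ⬝ᵥ (A ^ (t + 2) *ᵥ (1 : Fin n → ℝ)) := by
        rw [hN]; simp only; rw [Real.sq_sqrt (dotProduct_self_nonneg_real _), e]
      rw [h2]; exact hCS _ _
    have h3 : N t * (r * N (t + 1)) ≤ N t * N (t + 2) := by
      calc N t * (r * N (t + 1)) = (r * N t) * N (t + 1) := by ring
        _ ≤ N (t + 1) * N (t + 1) := mul_le_mul_of_nonneg_right hge hpos'.le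
        _ = N (t + 1) ^ 2 := by ring
        _ ≤ _ := h1
    exact le_of_mul_le_mul_left h3 hpos

lemma pow_mulVec_one_nonneg (h0 : ∀ i j, 0 ≤ A i j) (t : ℕ) (i : Fin n) :
    0 ≤ (A ^ t *ᵥ 1) i := by
  induction t generalizing i with
  | zero => simp
  | succ t ih =>
    rw [pow_succ_mulVec]
    change 0 ≤ ∑ j, A i j * (A ^ t *ᵥ 1) j
    exact Finset.sum_nonneg fun j _ => mul_nonneg (h0 i j) (ih j)

lemma diffusionCentrality_apply (δ : ℝ) (T : ℕ) (i : Fin n) :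
    diffusionCentrality δ T A i = ∑ t ∈ Finset.Icc 1 T, δ ^ t * (A ^ t *ᵥ 1) i := by
  rw [diffusionCentrality, Matrix.sum_mulVec, Finset.sum_apply]
  simp [Matrix.smul_mulVec]

lemma degreeCentrality_eq_diffusionCentrality :
    degreeCentrality A = diffusionCentrality 1 1 A := by
  simp [degreeCentrality, diffusionCentrality]

/-- Diffusion centralities of a dense nonnegative symmetric matrix are delocalized. -/
lemma isDelocalized_diffusionCentrality (hn : 1 ≤ n) (hs : A.IsSymm) {p c : ℝ} (hp : 0 < p)
    (hc : 0 < c) (h0 : ∀ i j, 0 ≤ A i j) (hA : ∀ i j, A i j ≤ p)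
    (hd : c * p * n ^ 2 ≤ 1 ⬝ᵥ (A *ᵥ 1)) {δ : ℝ} (hδ : 0 < δ) {T : ℕ} (hT : 1 ≤ T) :
    IsDelocalized (T / c) (diffusionCentrality δ T A) := by
  have hn0 : (0 : ℝ) < n := by exact_mod_cast hn
  have hs0 : 0 < √(n : ℝ) := Real.sqrt_pos.2 hn0
  have hss : √(n : ℝ) ^ 2 = n := Real.sq_sqrt hn0.le
  have hr : 0 < c * p * n := by positivity
  have hgrow := pow_mulVec_growth hs hr hn (by linarith [sq (n : ℝ)] : c * p * n * n ≤ _)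
  set N : ℕ → ℝ := fun t => √((A ^ t *ᵥ 1) ⬝ᵥ (A ^ t *ᵥ 1)) with hN
  set C := diffusionCentrality δ T A with hC
  have hterm0 : ∀ t i, 0 ≤ δ ^ t * (A ^ t *ᵥ 1) i := fun t i =>
    mul_nonneg (by positivity) (pow_mulVec_one_nonneg h0 t i)
  have hC0 : ∀ i, 0 ≤ C i := fun i => by
    rw [hC, diffusionCentrality_apply]; exact Finset.sum_nonneg fun t _ => hterm0 t i
  -- Nothing cancels between nonnegative vectors, so the norm of the sum dominates that of each
  -- summand.
  have hnorm : ∀ t ∈ Finset.Icc 1 T, δ ^ t * N t ≤ √(C ⬝ᵥ C) := by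
    intro t ht
    refine Real.le_sqrt_of_sq_le ?_
    rw [mul_pow, Real.sq_sqrt (dotProduct_self_nonneg_real _), dotProduct, dotProduct, Finset.mul_sum]
    refine Finset.sum_le_sum fun i _ => ?_
    have h1 : δ ^ t * (A ^ t *ᵥ 1) i ≤ C i := by
      rw [hC, diffusionCentrality_apply]
      exact Finset.single_le_sum (f := fun t => δ ^ t * (A ^ t *ᵥ 1) i)
        (fun s _ => hterm0 s i) ht
    calc (δ ^ t) ^ 2 * ((A ^ t *ᵥ 1) i * (A ^ t *ᵥ 1) i)
        = (δ ^ t * (A ^ t *ᵥ 1) i) * (δ ^ t * (A ^ t *ᵥ 1) i) := by ring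
      _ ≤ C i * C i := mul_le_mul h1 h1 (hterm0 t i) (hC0 i)
  have hsqrt0 : 0 < √(C ⬝ᵥ C) :=
    lt_of_lt_of_le (mul_pos (by positivity) (hgrow 1).1)
      (hnorm 1 (Finset.mem_Icc.2 ⟨le_rfl, hT⟩))
  refine ⟨Real.sqrt_pos.1 hsqrt0, fun i => ?_⟩
  -- Each summand is flat relative to the norm of the whole sum; adding `T` of them produces the
  -- constant `T / c`.
  have hentry : ∀ t ∈ Finset.Icc 1 T, δ ^ t * (A ^ t *ᵥ 1) i ≤ √(C ⬝ᵥ C) / (c * √n) := by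
    intro t ht
    obtain ⟨s, rfl⟩ := Nat.exists_eq_add_of_le' (Finset.mem_Icc.1 ht).1
    have h1 : (A ^ (s + 1) *ᵥ 1) i ≤ p * √n * N s := by
      rw [pow_succ_mulVec]
      exact (le_abs_self _).trans (abs_mulVec_le hp.le h0 hA _ i)
    have h2 : (A ^ (s + 1) *ᵥ 1) i * (c * √n) ≤ N (s + 1) := by
      calc (A ^ (s + 1) *ᵥ 1) i * (c * √n) ≤ p * √n * N s * (c * √n) :=
            mul_le_mul_of_nonneg_right h1 (by positivity)
        _ = c * p * √n ^ 2 * N s := by ring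
        _ = c * p * n * N s := by rw [hss]
        _ ≤ _ := (hgrow s).2
    rw [le_div_iff₀ (by positivity), mul_assoc]
    exact (mul_le_mul_of_nonneg_left h2 (by positivity)).trans (hnorm _ ht)
  rw [abs_of_nonneg (hC0 i), hC, diffusionCentrality_apply, ← hC]
  refine (Finset.sum_le_sum hentry).trans (le_of_eq ?_)
  rw [Finset.sum_const, Nat.card_Icc, nsmul_eq_mul]
  simp only [Nat.add_sub_cancel]
  field_simp

end Matrices

/-! ### The adjacency matrix: bounds and measurability -/

section Adjacency

variable {f : I → I → ℝ} {p : ℝ} {n : ℕ}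

lemma IsGraphon.measurable_comp {β : Type*} [MeasurableSpace β] (hf : IsGraphon f) {X Y : β → I}
    (hX : Measurable X) (hY : Measurable Y) : Measurable fun b => f (X b) (Y b) := by
  have : Measurable (Function.uncurry f ∘ fun b => (X b, Y b)) :=
    hf.measurable.comp (hX.prodMk hY)
  exact this

lemma adjacency_isSymm (u : Fin n → I) : (adjacency f p u).IsSymm := by
  ext i j
  simp only [adjacency, Matrix.transpose_apply, Matrix.of_apply]
  rcases lt_trichotomy i j with h | h | h
  · simp [h, h.not_gt]
  · simp [h]
  · simp [h, h.not_gt]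

lemma adjacency_nonneg (hf : IsGraphon f) (hp : 0 ≤ p) (u : Fin n → I) (i j : Fin n) :
    0 ≤ adjacency f p u i j := by
  simp only [adjacency, Matrix.of_apply]
  split_ifs
  · exact mul_nonneg hp (hf.nonneg _ _)
  · exact mul_nonneg hp (hf.nonneg _ _)
  · exact le_rfl

lemma adjacency_le (hf : IsGraphon f) (hp : 0 ≤ p) (u : Fin n → I) (i j : Fin n) :
    adjacency f p u i j ≤ p := by
  simp only [adjacency, Matrix.of_apply]
  split_ifs
  · exact mul_le_of_le_one_right hp (hf.le_one _ _)
  · exact mul_le_of_le_one_right hp (hf.le_one _ _)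
  · exact hp

lemma measurable_adjacency_apply (hf : IsGraphon f) (i j : Fin n) :
    Measurable fun u : Fin n → I => adjacency f p u i j := by
  have h : ∀ i j : Fin n, Measurable fun u : Fin n → I => f (u i) (u j) := fun i j =>
    hf.measurable_comp (measurable_pi_apply i) (measurable_pi_apply j)
  simp only [adjacency, Matrix.of_apply]
  split_ifs
  · exact (h i j).const_mul p
  · exact (h j i).const_mul p
  · exact measurable_const

lemma measurable_diffusionCentrality (hf : IsGraphon f) (δ : ℝ) (T : ℕ) :
    Measurable fun u : Fin n → I => diffusionCentrality δ T (adjacency f p u) := by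
  have hpow : ∀ (t : ℕ) (i : Fin n),
      Measurable fun u : Fin n → I => (adjacency f p u ^ t *ᵥ 1) i := by
    intro t
    induction t with
    | zero => intro i; simp
    | succ t ih =>
      intro i
      simp only [pow_succ_mulVec]
      change Measurable fun u : Fin n → I => ∑ j, adjacency f p u i j * (adjacency f p u ^ t *ᵥ 1) j
      exact Finset.measurable_fun_sum _ fun j _ => (measurable_adjacency_apply hf i j).mul (ih j)
  refine measurable_pi_lambda _ fun i => ?_
  simp only [diffusionCentrality_apply]
  exact Finset.measurable_fun_sum _ fun t _ => (hpow t i).const_mul _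

lemma measurable_eigenvectorCentrality (hf : IsGraphon f)
    {v₁ : (n : ℕ) → Matrix (Fin n) (Fin n) ℝ → Fin n → ℝ} (hv : IsLeadingEigenvectorMap v₁)
    (a : ℝ) : Measurable fun u : Fin n → I => eigenvectorCentrality v₁ a (adjacency f p u) := by
  have h1 : Measurable fun (u : Fin n → I) (i j : Fin n) => adjacency f p u i j :=
    measurable_pi_lambda _ fun i => measurable_pi_lambda _ fun j => measurable_adjacency_apply hf i j
  exact ((hv.measurable n).comp h1).const_smul a

/-- The lower triangle copies the upper one, so the two contribute equally even when `f` is not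
symmetric. -/
lemma one_dotProduct_adjacency_mulVec_one (u : Fin n → I) :
    1 ⬝ᵥ (adjacency f p u *ᵥ 1)
      = 2 * p * ∑ i, ∑ j, if i < j then f (u i) (u j) else 0 := by
  have h1 : (1 : Fin n → ℝ) ⬝ᵥ (adjacency f p u *ᵥ 1) = ∑ i, ∑ j, adjacency f p u i j := by
    simp [dotProduct, Matrix.mulVec]
  have h2 : ∀ i j, adjacency f p u i j = p * (if i < j then f (u i) (u j) else 0)
      + p * (if j < i then f (u j) (u i) else 0) := by
    intro i j
    simp only [adjacency, Matrix.of_apply]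
    rcases lt_trichotomy i j with h | h | h
    · simp [h, h.not_gt]
    · simp [h]
    · simp [h, h.not_gt]
  rw [h1]
  simp only [h2, Finset.sum_add_distrib, ← Finset.mul_sum]
  rw [Finset.sum_comm (f := fun i j => if j < i then f (u j) (u i) else 0)]
  ring

end Adjacency

/-! ### Concentration of the number of links -/

section EdgeDensity

variable {Ω : Type*} [mΩ : MeasurableSpace Ω] {P : Measure Ω}
  {U : ℕ → Ω → I} {ε : ℕ → Ω → ℝ} {f : I → I → ℝ}

lemma IsSample.iIndepFun_type (h : IsSample P U ε) : iIndepFun U P :=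
  h.indep.comp (fun _ z => z.1) fun _ => measurable_fst

variable [IsProbabilityMeasure P]

lemma IsSample.integral_link (h : IsSample P U ε) (hf : IsGraphon f) {i j : ℕ} (hij : i ≠ j) :
    ∫ ω, f (U i ω) (U j ω) ∂P = ∫ z : I × I, f z.1 z.2 := by
  have hi := h.iIndepFun_type.indepFun hij
  rw [indepFun_iff_map_prod_eq_prod_map_map (h.measurable_type i).aemeasurable
    (h.measurable_type j).aemeasurable, h.uniform i, h.uniform j] at hi
  have hm := (h.measurable_type i).prodMk (h.measurable_type j)
  have e := integral_map (μ := P) hm.aemeasurable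
    (f := fun z : I × I => f z.1 z.2) hf.measurable.aestronglyMeasurable
  rw [hi] at e
  exact e.symm

/-- Second moment bound for the centred number of links. -/
lemma IsSample.integral_sq_centred_links_le (h : IsSample P U ε) (hf : IsGraphon f) (n : ℕ) :
    ∫ ω, (∑ i : Fin n, ∑ j : Fin n,
      if i < j then f (U i ω) (U j ω) - ∫ z : I × I, f z.1 z.2 else 0) ^ 2 ∂P ≤ 4 * n ^ 3 := by
  set m := ∫ z : I × I, f z.1 z.2 with hm
  have hfi : Integrable (fun z : I × I => f z.1 z.2) :=
    Integrable.of_bound hf.measurable.aestronglyMeasurable 1 (ae_of_all _ fun z => by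
      rw [Real.norm_eq_abs, abs_of_nonneg (hf.nonneg _ _)]; exact hf.le_one _ _)
  have hm0 : 0 ≤ m := integral_nonneg fun z => hf.nonneg _ _
  have hm1 : m ≤ 1 := by
    have := integral_mono hfi (integrable_const (1 : ℝ)) fun z => hf.le_one _ _
    simpa using this
  set X : Fin n × Fin n → Ω → ℝ := fun q ω =>
    if q.1 < q.2 then f (U q.1 ω) (U q.2 ω) - m else 0 with hX
  have hfm : ∀ i j : ℕ, Measurable fun ω => f (U i ω) (U j ω) := fun i j =>
    hf.measurable_comp (h.measurable_type i) (h.measurable_type j)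
  have hXm : ∀ q, Measurable (X q) := by
    intro q
    simp only [hX]
    split_ifs
    · exact (hfm _ _).sub_const m
    · exact measurable_const
  have hX1 : ∀ q ω, |X q ω| ≤ 1 := by
    intro q ω
    simp only [hX]
    split_ifs
    · rw [abs_le]
      constructor <;> linarith [hf.nonneg (U q.1 ω) (U q.2 ω), hf.le_one (U q.1 ω) (U q.2 ω)]
    · simp
  have hXX : ∀ q s, Integrable (fun ω => X q ω * X s ω) P := fun q s =>
    Integrable.of_bound ((hXm q).mul (hXm s)).aestronglyMeasurable 1 (ae_of_all _ fun ω => by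
      rw [Real.norm_eq_abs, abs_mul]
      exact mul_le_one₀ (hX1 q ω) (abs_nonneg _) (hX1 s ω))
  have hX0 : ∀ q, ∫ ω, X q ω ∂P = 0 := by
    intro q
    by_cases hq : q.1 < q.2
    · simp only [hX, hq, if_true]
      have hi : Integrable (fun ω => f (U q.1 ω) (U q.2 ω)) P :=
        Integrable.of_bound (hfm _ _).aestronglyMeasurable 1 (ae_of_all _ fun ω => by
          rw [Real.norm_eq_abs, abs_of_nonneg (hf.nonneg _ _)]; exact hf.le_one _ _)
      rw [integral_sub hi (integrable_const _),
        h.integral_link hf (fun e => hq.ne (Fin.ext e))]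
      simp [hm]
    · simp [hX, hq]
  set ind : Fin n → Fin n → ℝ := fun a b => if a = b then 1 else 0 with hind
  have hind0 : ∀ a b, 0 ≤ ind a b := by intro a b; simp only [hind]; split_ifs <;> norm_num
  -- Pairs with no common index give independent centred variables; every other product is at most
  -- 1. The four indicators count the coincidences and sum to `4 n³`.
  have hpair : ∀ q s : Fin n × Fin n, ∫ ω, X q ω * X s ω ∂P
      ≤ ind q.1 s.1 + ind q.1 s.2 + ind q.2 s.1 + ind q.2 s.2 := by
    intro q s
    have hone : ∫ ω, X q ω * X s ω ∂P ≤ 1 := by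
      have := integral_mono (hXX q s) (integrable_const (1 : ℝ)) fun ω =>
        (le_abs_self _).trans (by
          rw [abs_mul]; exact mul_le_one₀ (hX1 q ω) (abs_nonneg _) (hX1 s ω))
      simpa using this
    have p1 := hind0 q.1 s.1
    have p2 := hind0 q.1 s.2
    have p3 := hind0 q.2 s.1
    have p4 := hind0 q.2 s.2
    by_cases h1 : q.1 = s.1
    · have : ind q.1 s.1 = 1 := if_pos h1
      linarith
    by_cases h2 : q.1 = s.2
    · have : ind q.1 s.2 = 1 := if_pos h2
      linarith
    by_cases h3 : q.2 = s.1
    · have : ind q.2 s.1 = 1 := if_pos h3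
      linarith
    by_cases h4 : q.2 = s.2
    · have : ind q.2 s.2 = 1 := if_pos h4
      linarith
    have hne : ∀ {a b : Fin n}, a ≠ b → (a : ℕ) ≠ b := fun hab e => hab (Fin.ext e)
    have hindep := h.iIndepFun_type.indepFun_prodMk_prodMk h.measurable_type q.1 q.2 s.1 s.2
      (hne h1) (hne h2) (hne h3) (hne h4)
    have hφ : ∀ q : Fin n × Fin n, Measurable fun z : I × I =>
        if q.1 < q.2 then f z.1 z.2 - m else 0 := by
      intro q
      split_ifs
      · exact hf.measurable.sub_const m
      · exact measurable_const
    have hXi : IndepFun (X q) (X s) P := hindep.comp (hφ q) (hφ s)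
    rw [hXi.integral_fun_mul_eq_mul_integral (hXm q).aestronglyMeasurable
      (hXm s).aestronglyMeasurable, hX0, zero_mul]
    linarith
  have hexp : ∀ ω, (∑ i : Fin n, ∑ j : Fin n, if i < j then f (U i ω) (U j ω) - m else 0) ^ 2
      = ∑ q, ∑ s, X q ω * X s ω := by
    intro ω
    rw [← Fintype.sum_prod_type' (f := fun i j : Fin n =>
      if i < j then f (U i ω) (U j ω) - m else 0), sq, Finset.sum_mul_sum]
  simp only [hexp]
  rw [integral_finsetSum _ fun q _ => integrable_finsetSum _ fun s _ => hXX q s]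
  calc _ ≤ ∑ q : Fin n × Fin n, ∑ s : Fin n × Fin n,
        (ind q.1 s.1 + ind q.1 s.2 + ind q.2 s.1 + ind q.2 s.2) := by
        refine Finset.sum_le_sum fun q _ => ?_
        rw [integral_finsetSum _ fun s _ => hXX q s]
        exact Finset.sum_le_sum fun s _ => hpair q s
    _ = 4 * n ^ 3 := by
        have hrow : ∀ a, ∑ b, ind a b = 1 := fun a => by simp [hind]
        simp only [Finset.sum_add_distrib, Fintype.sum_prod_type, Finset.sum_const,
          Finset.card_univ, Fintype.card_prod, Fintype.card_fin, nsmul_eq_mul, Nat.cast_mul,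
          ← Finset.mul_sum, hrow, mul_one]
        ring

/-- With probability tending to one, the network is dense relative to its sparsity level. -/
lemma IsSample.tendsto_measure_sparse (h : IsSample P U ε) (hf : IsGraphon f) (p : ℕ → ℝ)
    (hp : ∀ n, 0 < p n) :
    Tendsto (fun n => P.real {ω | ¬ (∫ z : I × I, f z.1 z.2) / 4 * p n * (n : ℝ) ^ 2
      ≤ 1 ⬝ᵥ (adjacency f (p n) (fun j : Fin n => U j ω) *ᵥ 1)}) atTop (𝓝 0) := by
  set m := ∫ z : I × I, f z.1 z.2 with hm
  have hm0 : 0 < m := hf.integral_pos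
  set Q : ℕ → Ω → ℝ := fun n ω => ∑ i : Fin n, ∑ j : Fin n,
    if i < j then f (U i ω) (U j ω) - m else 0 with hQ
  -- Chebyshev's inequality gives `4 n³ / (m n² / 8)² = 256 / (m² n)`.
  have hlim : Tendsto (fun n : ℕ => 256 / m ^ 2 * (n : ℝ)⁻¹) atTop (𝓝 0) := by
    have h0 : Tendsto (fun n : ℕ => (n : ℝ)⁻¹) atTop (𝓝 0) :=
      tendsto_inv_atTop_zero.comp tendsto_natCast_atTop_atTop
    have := h0.const_mul (256 / m ^ 2)
    rwa [mul_zero] at this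
  refine tendsto_of_tendsto_of_tendsto_of_le_of_le' tendsto_const_nhds hlim
    (Eventually.of_forall fun n => measureReal_nonneg) ?_
  filter_upwards [eventually_ge_atTop 2] with n hn
  have hn2 : (2 : ℝ) ≤ n := by exact_mod_cast hn
  have hn0 : (0 : ℝ) < n := by linarith
  have hcount : ∑ i : Fin n, ∑ j : Fin n, (if i < j then (1 : ℝ) else 0) = n * (n - 1) / 2 := by
    have h1 : ∑ i : Fin n, ∑ j : Fin n, ((if i < j then (1 : ℝ) else 0) +
        (if j < i then 1 else 0) + if i = j then 1 else 0) = ∑ i : Fin n, ∑ j : Fin n, 1 := by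
      refine Finset.sum_congr rfl fun i _ => Finset.sum_congr rfl fun j _ => ?_
      rcases lt_trichotomy i j with h | h | h
      · simp [h, h.not_gt, h.ne]
      · simp [h]
      · simp [h, h.not_gt, h.ne']
    simp only [Finset.sum_add_distrib] at h1
    rw [Finset.sum_comm (f := fun i j : Fin n => if j < i then (1 : ℝ) else 0)] at h1
    simp at h1 ⊢
    linarith
  -- For `n ≥ 2` the mean `m n (n - 1) / 2` is at least `m n² / 4`. A deviation below `m n² / 8`
  -- leaves `m n² / 8`, and the factor `2 p` turns this into the density `m / 4`.
  have hsub : {ω | ¬ m / 4 * p n * (n : ℝ) ^ 2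
      ≤ 1 ⬝ᵥ (adjacency f (p n) (fun j : Fin n => U j ω) *ᵥ 1)}
      ⊆ {ω | (m * n ^ 2 / 8) ^ 2 ≤ Q n ω ^ 2} := by
    intro ω hω
    by_contra hlt
    refine hω ?_
    simp only [Set.mem_ofPred_eq, not_le] at hlt
    have habs := abs_lt_of_sq_lt_sq hlt (by positivity)
    have hsum : ∑ i : Fin n, ∑ j : Fin n, (if i < j then f (U i ω) (U j ω) else 0)
        = Q n ω + m * (n * (n - 1) / 2) := by
      rw [← hcount]
      simp only [hQ, Finset.mul_sum, ← Finset.sum_add_distrib]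
      refine Finset.sum_congr rfl fun i _ => Finset.sum_congr rfl fun j _ => ?_
      split_ifs <;> ring
    rw [one_dotProduct_adjacency_mulVec_one, hsum]
    have h1 : m * n ^ 2 / 8 ≤ Q n ω + m * (n * (n - 1) / 2) := by
      have := (abs_lt.1 habs).1
      nlinarith [mul_nonneg (mul_nonneg hm0.le hn0.le) (sub_nonneg.2 hn2)]
    calc m / 4 * p n * (n : ℝ) ^ 2 = 2 * p n * (m * n ^ 2 / 8) := by ring
      _ ≤ _ := mul_le_mul_of_nonneg_left h1 (by have := hp n; positivity)
  refine (measureReal_mono hsub).trans ?_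
  have hQm : Measurable (Q n) := by
    refine Finset.measurable_fun_sum _ fun i _ => Finset.measurable_fun_sum _ fun j _ => ?_
    split_ifs
    · exact (hf.measurable_comp (h.measurable_type i) (h.measurable_type j)).sub_const m
    · exact measurable_const
  have hQi : Integrable (fun ω => Q n ω ^ 2) P := by
    have hL : MemLp (Q n) 2 P := by
      refine memLp_finsetSum _ fun i _ => memLp_finsetSum _ fun j _ => ?_
      split_ifs
      · refine MemLp.sub (MemLp.of_bound (hf.measurable_comp (h.measurable_type i)
          (h.measurable_type j)).aestronglyMeasurable 1 (ae_of_all _ fun ω => ?_)) (memLp_const m)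
        rw [Real.norm_eq_abs, abs_of_nonneg (hf.nonneg _ _)]
        exact hf.le_one _ _
      · exact memLp_const 0
    exact hL.integrable_sq
  have hmarkov := mul_meas_ge_le_integral_of_nonneg (ae_of_all P fun ω => sq_nonneg (Q n ω)) hQi
    ((m * n ^ 2 / 8) ^ 2)
  have hle := hmarkov.trans (h.integral_sq_centred_links_le hf n)
  have hpos : 0 < (m * (n : ℝ) ^ 2 / 8) ^ 2 := by positivity
  rw [mul_comm, ← le_div_iff₀ hpos] at hle
  refine hle.trans (le_of_eq ?_)
  field_simp
  norm_num

end EdgeDensity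

/-! ### From the model assumptions to the limit theorem -/

section Model

variable {Ω : Type*} [mΩ : MeasurableSpace Ω] {P : Measure Ω} [IsProbabilityMeasure P]
  {U : ℕ → Ω → I} {ε : ℕ → Ω → ℝ} {f : I → I → ℝ} {σlo σhi κ₃ : ℝ}

/-- The conditional variances of the errors have versions that are functions of the types and
satisfy the assumed bounds everywhere. -/
lemma IsSample.exists_errorModel (h : IsSample P U ε) (hmom : CondMoments P U ε σlo σhi κ₃) :
    ∃ g : ℕ → I → ℝ, ErrorModel P U ε g σlo σhi κ₃ := by
  have hσ : σlo ^ 2 ≤ σhi ^ 2 := by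
    obtain ⟨ω, h1, h2⟩ := ((hmom.var_lower 0).and (hmom.var_upper 0)).exists
    exact h1.trans h2
  have hfac : ∀ i, ∃ g : I → ℝ, Measurable g ∧
      P[fun ω => ε i ω ^ 2 | MeasurableSpace.comap (U i) inferInstance] = g ∘ U i := fun i =>
    (stronglyMeasurable_condExp.measurable : Measurable[MeasurableSpace.comap (U i) inferInstance]
      (P[fun ω => ε i ω ^ 2 | MeasurableSpace.comap (U i) inferInstance])).exists_eq_measurable_comp
  choose g hgm hg using hfac
  -- Clipping to `[σlo², σhi²]` alters `g i ∘ U i` only on a null set.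
  have hgv : ∀ i, (fun ω => max (σlo ^ 2) (min (σhi ^ 2) (g i (U i ω)))) =ᵐ[P]
      P[fun ω => ε i ω ^ 2 | MeasurableSpace.comap (U i) inferInstance] := by
    intro i
    filter_upwards [hmom.var_lower i, hmom.var_upper i] with ω h1 h2
    have e : condExpGiven P (fun ω => ε i ω ^ 2) (U i) ω = g i (U i ω) := congrFun (hg i) ω
    rw [hg i, Function.comp_apply]
    rw [e] at h1 h2
    rw [min_eq_right h2, max_eq_right h1]
  have hsq : ∀ i, Integrable (fun ω => ε i ω ^ 2) P := fun i =>
    ((memLp_three_of_integrable (h.measurable_error i) (hmom.integrable i)).mono_exponent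
      (by norm_num : (2 : ENNReal) ≤ 3)).integrable_sq
  have hgm' : ∀ i, Measurable fun u => max (σlo ^ 2) (min (σhi ^ 2) (g i u)) := fun i =>
    measurable_const.max (measurable_const.min (hgm i))
  refine ⟨fun i u => max (σlo ^ 2) (min (σhi ^ 2) (g i u)), ?_⟩
  refine
    { measurable_type := h.measurable_type
      measurable_error := h.measurable_error
      indep := h.indep
      measurable_var := hgm'
      σlo_pos := hmom.σlo_pos
      le_var := fun i u => le_max_left _ _
      var_le := fun i u => max_le hσ (min_le_left _ _)
      integrable := hmom.integrable
      third_moment := fun i => ?_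
      mean_zero := hmom.mean_zero
      condVar := fun i => ?_ }
  · rw [← integral_condExp (h.measurable_type i).comap_le]
    have := integral_mono_ae integrable_condExp (integrable_const κ₃) (hmom.third_moment i)
    simpa using this
  · have hi : Integrable (fun ω => max (σlo ^ 2) (min (σhi ^ 2) (g i (U i ω)))) P :=
      integrable_condExp.congr (hgv i).symm
    have hle := (h.measurable_type i).comap_le
    have h1 := condExp_sub (hsq i) hi (MeasurableSpace.comap (U i) inferInstance)
    have hm : StronglyMeasurable[MeasurableSpace.comap (U i) inferInstance]
        fun ω => max (σlo ^ 2) (min (σhi ^ 2) (g i (U i ω))) :=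
      ((hgm' i).comp (comap_measurable (U i))).stronglyMeasurable
    rw [condExp_of_stronglyMeasurable hle hm hi] at h1
    filter_upwards [h1, hgv i] with ω h1 h2
    refine h1.trans ?_
    rw [Pi.sub_apply, h2, sub_self, Pi.zero_apply]

/-- Asymptotic normality of the t-statistic for any centrality that is delocalized on dense
networks. -/
lemma IsSample.asympStdNormal_tStat (h : IsSample P U ε) (hf : IsGraphon f)
    (hmom : CondMoments P U ε σlo σhi κ₃) (p : ℕ → ℝ) (hp : ∀ n, p n ∈ Set.Ioc (0 : ℝ) 1)
    {C : (n : ℕ) → Matrix (Fin n) (Fin n) ℝ → Fin n → ℝ} {K : ℝ}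
    (hC : ∀ n, Measurable fun u : Fin n → I => C n (adjacency f (p n) u))
    (hdel : ∀ n, 1 ≤ n → ∀ u : Fin n → I,
      (∫ z : I × I, f z.1 z.2) / 4 * p n * (n : ℝ) ^ 2 ≤ 1 ⬝ᵥ (adjacency f (p n) u *ᵥ 1) →
      IsDelocalized K (C n (adjacency f (p n) u)))
    (β : ℝ) : AsympStdNormal P (tStat f p U ε C β) := by
  obtain ⟨g, hg⟩ := h.exists_errorModel hmom
  refine hg.asympStdNormal_tStatistic (K := K) hC ?_ β
  refine tendsto_of_tendsto_of_tendsto_of_le_of_le' tendsto_const_nhds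
    (h.tendsto_measure_sparse hf p fun n => (hp n).1)
    (Eventually.of_forall fun n => measureReal_nonneg) ?_
  filter_upwards [eventually_ge_atTop 1] with n hn
  exact measureReal_mono fun ω hω hd => hω (hdel n hn _ hd)

end Model

end CentralityOLS

theorem theorem3 {Ω : Type*} [MeasurableSpace Ω] (P : Measure Ω) [IsProbabilityMeasure P]
    (f : I → I → ℝ) (hf : CentralityOLS.IsGraphon f)
    (U : ℕ → Ω → I) (ε : ℕ → Ω → ℝ) (hsample : CentralityOLS.IsSample P U ε)
    (σlo σhi κ₃ : ℝ) (hmom : CentralityOLS.CondMoments P U ε σlo σhi κ₃)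
    (p : ℕ → ℝ) (hp : ∀ n, p n ∈ Set.Ioc (0 : ℝ) 1) :
    -- (a) degree and diffusion centrality
    (Tendsto (fun n : ℕ => p n / (n : ℝ) ^ (-(3 / 2) : ℝ)) atTop atTop →
      (∀ β : ℝ, CentralityOLS.AsympStdNormal P
        (CentralityOLS.tStat f p U ε (fun _ A => CentralityOLS.degreeCentrality A) β)) ∧
      (∀ δ ∈ Set.Ioc (0 : ℝ) 1, ∀ T : ℕ, 1 ≤ T → ∀ β : ℝ, CentralityOLS.AsympStdNormal P
        (CentralityOLS.tStat f p U ε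
          (fun _ A => CentralityOLS.diffusionCentrality δ T A) β))) ∧
    -- (b) eigenvector centrality
    (∀ v₁ : (n : ℕ) → Matrix (Fin n) (Fin n) ℝ → Fin n → ℝ,
      CentralityOLS.IsLeadingEigenvectorMap v₁ →
      ∀ a : ℕ → ℝ, (∀ n, 0 < a n) → Tendsto a atTop atTop →
      ∀ β : ℝ, CentralityOLS.AsympStdNormal P
        (CentralityOLS.tStat f p U ε
          (fun n A => CentralityOLS.eigenvectorCentrality v₁ (a n) A) β)) := by
  have hm : 0 < (∫ z : I × I, f z.1 z.2) / 4 := div_pos hf.integral_pos (by norm_num)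
  have hdiff : ∀ δ ∈ Set.Ioc (0 : ℝ) 1, ∀ T : ℕ, 1 ≤ T → ∀ β : ℝ, CentralityOLS.AsympStdNormal P
      (CentralityOLS.tStat f p U ε (fun _ A => CentralityOLS.diffusionCentrality δ T A) β) :=
    fun δ hδ T hT β => hsample.asympStdNormal_tStat hf hmom p hp
      (fun n => CentralityOLS.measurable_diffusionCentrality hf δ T)
      (fun n hn u hd => CentralityOLS.isDelocalized_diffusionCentrality hn
        (CentralityOLS.adjacency_isSymm u) (hp n).1 hm
        (CentralityOLS.adjacency_nonneg hf (hp n).1.le u)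
        (CentralityOLS.adjacency_le hf (hp n).1.le u) hd hδ.1 hT) β
  refine ⟨fun _ => ⟨fun β => ?_, hdiff⟩, fun v₁ hv a ha _ β => ?_⟩
  · simpa only [CentralityOLS.degreeCentrality_eq_diffusionCentrality] using
      hdiff 1 ⟨one_pos, le_rfl⟩ 1 le_rfl β
  · exact hsample.asympStdNormal_tStat hf hmom p hp
      (fun n => CentralityOLS.measurable_eigenvectorCentrality hf hv (a n))
      (fun n hn u hd => (hv.leading n hn _ (CentralityOLS.adjacency_isSymm u)).isDelocalized hn
        (CentralityOLS.adjacency_isSymm u) (hp n).1 hm (ha n)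
        (CentralityOLS.adjacency_nonneg hf (hp n).1.le u)
        (CentralityOLS.adjacency_le hf (hp n).1.le u) hd) β
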